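/- **Setting.** Let $n,m\ge 1$, let $f_1,\dots,f_n:\mathbb R^l\to\mathbb R$ and $g_1,\dots,g_m:\mathbb R^d\to\mathbb R^l$ be differentiable, and put $f=\frac1n\sum_i f_i$, $g=\frac1m\sum_j g_j$, $\Phi(x)=f(g(x))$. Let $x_0\in\mathbb R^d$. Write $\|\cdot\|$ for the Euclidean norm and the operator norm, $\|\cdot\|_F$ for the Frobenius norm, $\partial$ for the Jacobian. Assume, with constants $L_f,L_g\ge 0$ and $L_\Phi,M_f,M_g,H_1,H_2,H_3>0$ and a real number $\Delta$, that for all $i,j$, all $x,x'\in\mathbb R^d$ and all $y,y'\in\mathbb R^l$: * $\Phi$ is bounded below and $\Phi(x_0)-\inf\Phi\le\Delta$; * $\|\partial g_j(x)-\partial g_j(x')\|_F\le L_g\|x-x'\|$, $\ \|\nabla f_i(y)-\nabla f_i(y')\|\le L_f\|y-y'\|$, and $\|(\partial g_j(x))^T\nabla f_i(g(x))-(\partial g_j(x'))^T\nabla f_i(g(x'))\|\le L_\Phi\|x-x'\|$ (given the other assumptions, the last inequality holds for instance with $L_\Phi=M_fL_g+M_g^2L_f$); * $\|\partial g_j(x)\|\le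 M_g$ and $\|\nabla f_i(y)\|\le M_f$; * $\frac1n\sum_i\|\nabla f_i(y)-\nabla f(y)\|^2\le H_1$, $\ \frac1m\sum_j\|\partial g_j(x)-\partial g(x)\|_F^2\le H_2$, $\ \frac1m\sum_j\|g_j(x)-g(x)\|^2\le H_3$. **Algorithm (STORM-Compositional).** The inputs are $\varepsilon,\eta>0$, $a_g,a_{\partial g},a_\Phi\in(0,1)$ and positive integers $B_g,B_{\partial g},B_f,S_g,S_{\partial g},S_f,T$. For a tuple $\mathcal B=(i_1,\dots,i_B)$ of indices put $q(x,\mathcal B)=\frac1B\sum_{k=1}^B q_{i_k}(x)$. All minibatches below are independent and sampled uniformly with replacement; $\mathcal S_0^g,\mathcal S_0^{\partial g},\mathcal S_0^f$ have sizes $S_g,S_{\partial g},S_f$, and $\mathcal B_{t+1}^g,\mathcal B_{t+1}^{\partial g},\mathcal B_{t+1}^f$ have sizes $B_g,B_{\partial g},B_f$. Set $$\boldsymbol g_0=g(x_0,\mathcal S_0^g),\qquad \boldsymbol G_0=\partial g(x_0,\mathcal S_0^{\partial g}),\qquad \boldsymbol F_0=\boldsymbol G_0^T\nabla f(\boldsymbol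 g_0,\mathcal S_0^f).$$ For $t=0,1,\dots,T$ let $\widetilde x_{t+1}=x_t-\eta\boldsymbol F_t$, $\ \gamma_t=\min\{\eta\varepsilon/\|\widetilde x_{t+1}-x_t\|,\tfrac12\}$, $\ x_{t+1}=x_t+\gamma_t(\widetilde x_{t+1}-x_t)$ (so $x_{t+1}=x_t$ if $\widetilde x_{t+1}=x_t$), and $$\boldsymbol g_{t+1}=(1-a_g)\boldsymbol g_t+a_g\,g(x_{t+1},\mathcal B^g_{t+1})+(1-a_g)\bigl[g(x_{t+1},\mathcal B^g_{t+1})-g(x_t,\mathcal B^g_{t+1})\bigr],$$ $$\boldsymbol G_{t+1}=(1-a_{\partial g})\boldsymbol G_t+a_{\partial g}\,\partial g(x_{t+1},\mathcal B^{\partial g}_{t+1})+(1-a_{\partial g})\bigl[\partial g(x_{t+1},\mathcal B^{\partial g}_{t+1})-\partial g(x_t,\mathcal B^{\partial g}_{t+1})\bigr],$$ $$\boldsymbol F_{t+1}=(1-a_\Phi)\boldsymbol F_t+a_\Phi\boldsymbol G_{t+1}^T\nabla f(\boldsymbol g_{t+1},\mathcal B^f_{t+1})+(1-a_\Phi)\bigl[\boldsymbol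 G_{t+1}^T\nabla f(\boldsymbol g_{t+1},\mathcal B^f_{t+1})-\boldsymbol G_t^T\nabla f(\boldsymbol g_t,\mathcal B^f_{t+1})\bigr].$$ The output $\widehat x$ is drawn uniformly from $x_1,\dots,x_T$, independently of everything else. An IFO (incremental first-order oracle) call takes an index and a point and returns $(f_i(y),\nabla f_i(y))$ or $(g_j(x),\partial g_j(x))$; the IFO complexity is the total number of such calls made in the run. **Statement.** Let $0<c\le C$. There is a constant $K>0$, depending only on $c$, $C$, $L_f$, $L_g$, $L_\Phi$, $M_f$, $M_g$, $H_1$, $H_2$, $H_3$, $\Delta$, such that the following holds in the above setting (for all $d,l,n,m$, $f_i$, $g_j$, $x_0$) and for every $\varepsilon>0$. If $\eta=1/L_\Phi$, the parameters $a_g,a_{\partial g},a_\Phi\in(0,1)$ lie in $[c\,\varepsilon,\,C\varepsilon]$, the batch sizes $B_g,B_{\partial g},B_f,S_g,S_{\partial g},S_f$ lie in $[c\,\varepsilon^{-1},\,C\varepsilon^{-1}]$, and $T$ lies in $[c\,\varepsilon^{-2},\,C\varepsilon^{-2}]$, then the output satisfies $$\mathbf E\|\nabla\Phi(\widehat x)\|\le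 K\varepsilon ,$$ and in every realization the total number of IFO calls is at most $K\varepsilon^{-3}$. -/

import Mathlib

open scoped BigOperators

namespace Storm

noncomputable section

/-! ### Vectors, Jacobians and the Frobenius norm -/

/-- `ℝᵈ` with the Euclidean norm. -/
abbrev Vec (d : ℕ) : Type := EuclideanSpace ℝ (Fin d)

/-- `l × d` real matrices, as linear maps `ℝᵈ → ℝˡ`.  The norm `‖A‖` is the operator norm induced
by the Euclidean norms, and the transpose of `A` is `ContinuousLinearMap.adjoint A`. -/
abbrev Jac (d l : ℕ) : Type := Vec d →L[ℝ] Vec l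

/-- Frobenius norm: square root of the sum of the squares of the matrix entries. -/
def frobNorm {d l : ℕ} (A : Jac d l) : ℝ :=
  Real.sqrt (∑ i : Fin l, ∑ k : Fin d, (A (EuclideanSpace.single k (1 : ℝ)) i) ^ 2)

/-! ### The compositional problem -/

/-- `f(y) = (1/n) ∑ᵢ fᵢ(y)`. -/
def outerFun {l n : ℕ} (f : Fin n → Vec l → ℝ) (y : Vec l) : ℝ :=
  (n : ℝ)⁻¹ * ∑ i, f i y

/-- `g(x) = (1/m) ∑ⱼ gⱼ(x)`. -/
def innerFun {d l m : ℕ} (g : Fin m → Vec d → Vec l) (x : Vec d) : Vec l :=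
  (m : ℝ)⁻¹ • ∑ j, g j x

/-- The objective `Φ(x) = f(g(x))`. -/
def objective {d l n m : ℕ} (f : Fin n → Vec l → ℝ) (g : Fin m → Vec d → Vec l) (x : Vec d) : ℝ :=
  outerFun f (innerFun g x)

/-- The constants appearing in the assumptions: Lipschitz constants, bounds, variance bounds and
(a bound on) the initial gap. -/
structure Constants where
  Lf : ℝ
  Lg : ℝ
  LΦ : ℝ
  Mf : ℝ
  Mg : ℝ
  H₁ : ℝ
  H₂ : ℝ
  H₃ : ℝ
  Δ : ℝ

/-- Signs of the constants. -/
structure Constants.Admissible (c : Constants) : Prop where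
  Lf_nonneg : 0 ≤ c.Lf
  Lg_nonneg : 0 ≤ c.Lg
  LΦ_pos : 0 < c.LΦ
  Mf_pos : 0 < c.Mf
  Mg_pos : 0 < c.Mg
  H₁_pos : 0 < c.H₁
  H₂_pos : 0 < c.H₂
  H₃_pos : 0 < c.H₃

/-- The standing assumptions on the functions `fᵢ`, `gⱼ` and on the initial point `x₀`.
`𝔼 i, _` is the average over a uniformly distributed index. -/
structure Assumptions {d l n m : ℕ} (c : Constants) (f : Fin n → Vec l → ℝ)
    (g : Fin m → Vec d → Vec l) (x₀ : Vec d) : Prop where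
  differentiable_f : ∀ i, Differentiable ℝ (f i)
  differentiable_g : ∀ j, Differentiable ℝ (g j)
  /- finite gap -/
  bddBelow : BddBelow (Set.range (objective f g))
  gap : objective f g x₀ - (⨅ x, objective f g x) ≤ c.Δ
  /- smoothness -/
  lipschitz_jacobian : ∀ j x x',
    frobNorm (fderiv ℝ (g j) x - fderiv ℝ (g j) x') ≤ c.Lg * ‖x - x'‖
  lipschitz_gradient : ∀ i y y',
    ‖gradient (f i) y - gradient (f i) y'‖ ≤ c.Lf * ‖y - y'‖
  lipschitz_composite : ∀ i j x x',
    ‖(fderiv ℝ (g j) x).adjoint (gradient (f i) (innerFun g x))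
        - (fderiv ℝ (g j) x').adjoint (gradient (f i) (innerFun g x'))‖ ≤ c.LΦ * ‖x - x'‖
  /- boundedness -/
  bound_jacobian : ∀ j x, ‖fderiv ℝ (g j) x‖ ≤ c.Mg
  bound_gradient : ∀ i y, ‖gradient (f i) y‖ ≤ c.Mf
  /- bounded variance -/
  variance_gradient : ∀ y,
    (𝔼 i, ‖gradient (f i) y - gradient (outerFun f) y‖ ^ 2) ≤ c.H₁
  variance_jacobian : ∀ x,
    (𝔼 j, frobNorm (fderiv ℝ (g j) x - fderiv ℝ (innerFun g) x) ^ 2) ≤ c.H₂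
  variance_value : ∀ x, (𝔼 j, ‖g j x - innerFun g x‖ ^ 2) ≤ c.H₃

/-! ### Computations that count their oracle calls -/

/-- A value together with the number of oracle calls made to compute it. -/
structure Counted (α : Type) where
  val : α
  calls : ℕ

instance : Monad Counted where
  pure a := ⟨a, 0⟩
  bind c k := ⟨(k c.val).val, c.calls + (k c.val).calls⟩

/-- Access to the component functions: `outer i y` and `inner j x` are single queries. -/
structure Oracle (d l n m : ℕ) where
  outer : Fin n → Vec l → Counted (ℝ × Vec l)
  inner : Fin m → Vec d → Counted (Vec l × Jac d l)

/-- The incremental first-order oracle: each query costs one call and returns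
`(fᵢ(y), ∇fᵢ(y))`, respectively `(gⱼ(x), ∂gⱼ(x))`. -/
def ifo {d l n m : ℕ} (f : Fin n → Vec l → ℝ) (g : Fin m → Vec d → Vec l) : Oracle d l n m where
  outer i y := ⟨(f i y, gradient (f i) y), 1⟩
  inner j x := ⟨(g j x, fderiv ℝ (g j) x), 1⟩

/-- Minibatch estimator `(1/B) ∑_{k < B} q_{b k}` for the minibatch `b`; one evaluation of `q` is
made for each member of the minibatch, counted with multiplicity. -/
def batchMean {ι V : Type} [AddCommGroup V] [Module ℝ V] {B : ℕ} (q : ι → Counted V)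
    (b : Fin B → ι) : Counted V :=
  ⟨(B : ℝ)⁻¹ • ∑ k, (q (b k)).val, ∑ k, (q (b k)).calls⟩

/-! ### The STORM-Compositional algorithm -/

/-- The input parameters other than the starting point.  `aJ`, `BJ`, `SJ` are the parameters
belonging to the Jacobian `∂g`. -/
structure Params where
  η : ℝ
  ε : ℝ
  ag : ℝ
  aJ : ℝ
  aΦ : ℝ
  Bg : ℕ
  BJ : ℕ
  Bf : ℕ
  Sg : ℕ
  SJ : ℕ
  Sf : ℕ
  T : ℕ

/-- The initial minibatches `(𝒮₀^g, 𝒮₀^∂g, 𝒮₀^f)`. -/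
abbrev StartBatch (n m : ℕ) (p : Params) : Type :=
  (Fin p.Sg → Fin m) × (Fin p.SJ → Fin m) × (Fin p.Sf → Fin n)

/-- The minibatches `(ℬ^g, ℬ^∂g, ℬ^f)` drawn in one iteration. -/
abbrev StepBatch (n m : ℕ) (p : Params) : Type :=
  (Fin p.Bg → Fin m) × (Fin p.BJ → Fin m) × (Fin p.Bf → Fin n)

/-- All random choices of a run: the initial minibatches, the minibatches of the iterations
`t = 0, …, T` (entry `t` is `ℬ_{t+1}`), and the index `k < T` of the output `x_{k+1}`.  A uniformly
distributed element of this finite product has independent, uniformly distributed components, i.e.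
all minibatches are sampled independently and with replacement, and the output is uniform among
`x₁, …, x_T` independently of them. -/
abbrev Randomness (n m : ℕ) (p : Params) : Type :=
  StartBatch n m p × (Fin (p.T + 1) → StepBatch n m p) × Fin p.T

/-- The variables `(x_t, 𝒈_t, 𝑮_t, 𝑭_t)` of the algorithm. -/
structure State (d l : ℕ) where
  x : Vec d
  g : Vec l
  G : Jac d l
  F : Vec d

variable {d l n m : ℕ}

/-- Minibatch estimate `g(x, b)`. -/
def Oracle.meanValue (O : Oracle d l n m) {B : ℕ} (b : Fin B → Fin m) (x : Vec d) :
    Counted (Vec l) :=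
  batchMean (fun j => do let r ← O.inner j x; pure r.1) b

/-- Minibatch estimate `∂g(x, b)`. -/
def Oracle.meanJacobian (O : Oracle d l n m) {B : ℕ} (b : Fin B → Fin m) (x : Vec d) :
    Counted (Jac d l) :=
  batchMean (fun j => do let r ← O.inner j x; pure r.2) b

/-- Minibatch estimate `∇f(y, b)`. -/
def Oracle.meanGradient (O : Oracle d l n m) {B : ℕ} (b : Fin B → Fin n) (y : Vec l) :
    Counted (Vec l) :=
  batchMean (fun i => do let r ← O.outer i y; pure r.2) b

/-- Initialization of `𝒈₀`, `𝑮₀`, `𝑭₀`. -/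
def start (O : Oracle d l n m) (p : Params) (x₀ : Vec d) (b : StartBatch n m p) :
    Counted (State d l) := do
  let g₀ ← O.meanValue b.1 x₀
  let G₀ ← O.meanJacobian b.2.1 x₀
  let v ← O.meanGradient b.2.2 g₀
  pure { x := x₀, g := g₀, G := G₀, F := G₀.adjoint v }

/-- The new iterate `x_{t+1} = x_t + γ_t (x̃_{t+1} - x_t)`, where `x̃_{t+1} = x_t - η 𝑭_t` and
`γ_t = min (η ε / ‖x̃_{t+1} - x_t‖) (1/2)`.  If `x̃_{t+1} = x_t`, then `x_{t+1} = x_t` for every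
value of `γ_t`, so the convention for the quotient by zero does not matter. -/
def nextPoint (p : Params) (s : State d l) : Vec d :=
  let xtilde := s.x - p.η • s.F
  let γ := min (p.η * p.ε / ‖xtilde - s.x‖) (1 / 2)
  s.x + γ • (xtilde - s.x)

/-- One iteration of the loop. -/
def step (O : Oracle d l n m) (p : Params) (s : State d l) (b : StepBatch n m p) :
    Counted (State d l) := do
  let x' := nextPoint p s
  let gNew ← O.meanValue b.1 x'
  let gOld ← O.meanValue b.1 s.x
  let g' := (1 - p.ag) • s.g + p.ag • gNew + (1 - p.ag) • (gNew - gOld)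
  let JNew ← O.meanJacobian b.2.1 x'
  let JOld ← O.meanJacobian b.2.1 s.x
  let G' := (1 - p.aJ) • s.G + p.aJ • JNew + (1 - p.aJ) • (JNew - JOld)
  let vNew ← O.meanGradient b.2.2 g'
  let vOld ← O.meanGradient b.2.2 s.g
  let F' := (1 - p.aΦ) • s.F + p.aΦ • G'.adjoint vNew
    + (1 - p.aΦ) • (G'.adjoint vNew - s.G.adjoint vOld)
  pure { x := x', g := g', G := G', F := F' }

/-- The state after `t` iterations, i.e. `(x_t, 𝒈_t, 𝑮_t, 𝑭_t)`, with the calls made so far.  Only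
`t ≤ T + 1` is used, so the reduction of the index modulo `T + 1` plays no role. -/
def iterate (O : Oracle d l n m) (p : Params) (x₀ : Vec d) (ω : Randomness n m p) :
    ℕ → Counted (State d l)
  | 0 => start O p x₀ ω.1
  | t + 1 => do
      let s ← iterate O p x₀ ω t
      step O p s (ω.2.1 (Fin.ofNat (p.T + 1) t))

/-- STORM-Compositional: run the iterations `t = 0, …, T` and return the chosen `x_{k+1}`; the
count is that of the whole run. -/
def algorithm (O : Oracle d l n m) (p : Params) (x₀ : Vec d) (ω : Randomness n m p) :
    Counted (Vec d) where
  val := (iterate O p x₀ ω (ω.2.2 + 1)).val.x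
  calls := (iterate O p x₀ ω (p.T + 1)).calls

/-! ### The asymptotic parameter choice -/

/-- `c q ≤ u ≤ C q`. -/
def OfOrder (c C u q : ℝ) : Prop := c * q ≤ u ∧ u ≤ C * q

/-- The `a`-parameters lie in `(0, 1)` and are of order `ε`, the batch sizes of order `ε⁻¹` and
`T` of order `ε⁻²`, all with constants `c` and `C`; moreover `η = 1 / L_Φ`. -/
structure Params.Scaled (p : Params) (LΦ c C : ℝ) : Prop where
  ε_pos : 0 < p.ε
  η_eq : p.η = 1 / LΦ
  ag_mem : p.ag ∈ Set.Ioo (0 : ℝ) 1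
  aJ_mem : p.aJ ∈ Set.Ioo (0 : ℝ) 1
  aΦ_mem : p.aΦ ∈ Set.Ioo (0 : ℝ) 1
  ag : OfOrder c C p.ag p.ε
  aJ : OfOrder c C p.aJ p.ε
  aΦ : OfOrder c C p.aΦ p.ε
  Bg : OfOrder c C p.Bg p.ε⁻¹
  BJ : OfOrder c C p.BJ p.ε⁻¹
  Bf : OfOrder c C p.Bf p.ε⁻¹
  Sg : OfOrder c C p.Sg p.ε⁻¹
  SJ : OfOrder c C p.SJ p.ε⁻¹
  Sf : OfOrder c C p.Sf p.ε⁻¹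
  T : OfOrder c C p.T (p.ε⁻¹ ^ 2)

end

end Storm

namespace Storm

/-! ### Uniform expectations over finite products -/

/-! The gradient estimator `F` is accurate on average along the run, and the truncated gradient step
turns this accuracy into small gradients. The target is that the expected squared errors, summed
over the `T ~ ε⁻²` iterations, stay bounded, i.e. that they are of order `ε²` on average.

For `g` and `G` this follows from `storm_step`. Both points of an iteration are evaluated on the
same minibatch, so the new error is `1 - a` times the old one plus a centred minibatch mean. The
cross term averages to zero, and the noise has size `B⁻¹ (a² + step²) ~ ε³`, because steps have
length at most `ηε`. Over `T` steps the noise adds up to order `ε`, as does the initial error `S⁻¹`;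
dividing by the contraction rate `a ~ ε` leaves a constant (`sum_le_of_contraction_of_order`).

`F` obeys the same recursion around `Gᵀ∇f(g)`, given the new `g` and `G` (`expect_outerError_step`).
Its noise also contains the squared increments of `g` and `G`, which `storm_increment` bounds by
terms of order `ε²` and by `a²` times the errors already summed. The deterministic bound
`norm_step_G_le` on `‖G‖` makes this uniform. The three errors combine in `totalError_le`.

Pathwise, the descent inequality gives `gradient_nextPoint_le`: `ε‖∇Φ(x_{t+1})‖` is at most a
multiple of the decrease of `Φ`, plus the squared error of `F_t`, plus `2ε²`. Summing telescopes the
decreases to `Δ`, and dividing by `εT`, which is at least `c/ε`, gives order `ε`. The oracle count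
is an exact formula for every realization. -/

lemma expect_mono {ι : Type*} [Fintype ι] {f g : ι → ℝ} (h : ∀ i, f i ≤ g i) :
    (𝔼 i, f i) ≤ 𝔼 i, g i :=
  Finset.expect_le_expect fun i _ => h i

lemma expect_le_const {ι : Type*} [Fintype ι] [Nonempty ι] {f : ι → ℝ} {a : ℝ}
    (h : ∀ i, f i ≤ a) : (𝔼 i, f i) ≤ a :=
  Finset.expect_le Finset.univ_nonempty fun i _ => h i

lemma expect_prod {α β : Type*} [Fintype α] [Fintype β] (f : α × β → ℝ) :
    (𝔼 x, f x) = 𝔼 a, 𝔼 b, f (a, b) := by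
  rw [← Finset.univ_product_univ]
  exact Finset.expect_product _ _ _

lemma expect_const_add {ι : Type*} [Fintype ι] [Nonempty ι] (a : ℝ) (f : ι → ℝ) :
    (𝔼 i, (a + f i)) = a + 𝔼 i, f i := by
  rw [Finset.expect_add_distrib, Fintype.expect_const]

/-- Redrawing one coordinate of a uniformly distributed tuple does not change its law. -/
lemma expect_resample {ι α : Type*} [Fintype ι] [DecidableEq ι] [Fintype α] [Nonempty α]
    (i : ι) (h : (ι → α) → ℝ) :
    (𝔼 ω, h ω) = 𝔼 ω, 𝔼 b, h (Function.update ω i b) := by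
  -- Exchanging coordinate `i` with an independent extra sample is its own inverse, hence a
  -- bijection, and so preserves the uniform average.
  have hinv : Function.Involutive
      (fun x : (ι → α) × α => (Function.update x.1 i x.2, x.1 i)) := by
    rintro ⟨ω, b⟩
    simp
  calc (𝔼 ω, h ω) = 𝔼 ω, 𝔼 _b : α, h ω := by simp_rw [Fintype.expect_const]
    _ = 𝔼 x : (ι → α) × α, h x.1 := (expect_prod fun x : (ι → α) × α => h x.1).symm
    _ = 𝔼 x : (ι → α) × α, h (Function.update x.1 i x.2) :=
        (Fintype.expect_equiv hinv.toPerm _ _ fun x => rfl).symm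
    _ = _ := expect_prod _

lemma expect_apply_coord {ι α : Type*} [Fintype ι] [DecidableEq ι] [Fintype α] [Nonempty α]
    (i : ι) (h : α → ℝ) : (𝔼 ω : ι → α, h (ω i)) = 𝔼 b, h b := by
  rw [expect_resample i]
  simp

lemma batch_sub {ι V : Type*} [AddCommGroup V] [Module ℝ V] {B : ℕ} (hB : 0 < B)
    (q : ι → V) (μ : V) (b : Fin B → ι) :
    (B : ℝ)⁻¹ • ∑ k, q (b k) - μ = (B : ℝ)⁻¹ • ∑ k, (q (b k) - μ) := by
  have hB' : (B : ℝ) ≠ 0 := by positivity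
  rw [Finset.sum_sub_distrib, smul_sub, Finset.sum_const, Finset.card_univ, Fintype.card_fin,
    ← Nat.cast_smul_eq_nsmul ℝ, inv_smul_smul₀ hB']

/-! ### Variance of minibatch means and the STORM recursion in a Hilbert space. -/

section InnerProduct

variable {ι V : Type*} [Fintype ι] [Nonempty ι] [NormedAddCommGroup V] [InnerProductSpace ℝ V]

/-- The variance of a sum of independent centred vectors is the sum of the variances. -/
lemma expect_norm_sq_sum {B : ℕ} (q : ι → V) (hq : ∑ i, q i = 0) :
    (𝔼 b : Fin B → ι, ‖∑ k, q (b k)‖ ^ 2) = B * 𝔼 i, ‖q i‖ ^ 2 := by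
  have hcross : ∀ k k' : Fin B, (𝔼 b : Fin B → ι, inner ℝ (q (b k)) (q (b k')))
      = if k = k' then 𝔼 i, ‖q i‖ ^ 2 else 0 := by
    intro k k'
    split_ifs with h
    · subst h
      simp_rw [real_inner_self_eq_norm_sq]
      exact expect_apply_coord k fun i => ‖q i‖ ^ 2
    -- Redraw entry `k` alone: the factor with index `k'` stays fixed, and the average over the new
    -- entry vanishes because `q` is centred.
    · rw [expect_resample k]
      refine Finset.expect_eq_zero fun b _ => ?_
      simp only [Function.update_self, Function.update_of_ne (Ne.symm h)]
      rw [Fintype.expect_eq_sum_div_card, ← sum_inner, hq, inner_zero_left, zero_div]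
  simp_rw [← real_inner_self_eq_norm_sq, sum_inner, inner_sum]
  rw [Finset.expect_sum_comm]
  simp_rw [Finset.expect_sum_comm, hcross]
  simp

lemma expect_norm_sq_batch {B : ℕ} (hB : 0 < B) (q : ι → V) (hq : ∑ i, q i = 0) :
    (𝔼 b : Fin B → ι, ‖(B : ℝ)⁻¹ • ∑ k, q (b k)‖ ^ 2) = (B : ℝ)⁻¹ * 𝔼 i, ‖q i‖ ^ 2 := by
  have hB' : (B : ℝ) ≠ 0 := by positivity
  simp_rw [norm_smul, mul_pow]
  rw [← Finset.mul_expect, expect_norm_sq_sum q hq]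
  rw [Real.norm_of_nonneg (by positivity)]
  field_simp

/-- The hypothesis says that `μ` is the mean of `q`, so the cross term drops out and the second
moment splits as variance plus `‖μ‖²`. -/
lemma expect_norm_sub_sq_le (q : ι → V) (μ : V) (h : ∑ i, (q i - μ) = 0) :
    (𝔼 i, ‖q i - μ‖ ^ 2) ≤ 𝔼 i, ‖q i‖ ^ 2 := by
  have key : (𝔼 i, ‖q i‖ ^ 2) = (𝔼 i, ‖q i - μ‖ ^ 2) + ‖μ‖ ^ 2 := by
    have h1 : ∀ i, ‖q i‖ ^ 2 = ‖q i - μ‖ ^ 2 + (2 * inner ℝ (q i - μ) μ + ‖μ‖ ^ 2) := by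
      intro i
      have := norm_add_sq_real (q i - μ) μ
      rw [sub_add_cancel] at this
      rw [this]; ring
    simp_rw [h1]
    rw [Finset.expect_add_distrib, Finset.expect_add_distrib, Fintype.expect_const,
      ← Finset.mul_expect, Fintype.expect_eq_sum_div_card (fun i => inner ℝ (q i - μ) μ),
      ← sum_inner, h]
    simp
  rw [key]
  exact le_add_of_nonneg_right (by positivity)

lemma norm_add_sq_le_two (x y : V) : ‖x + y‖ ^ 2 ≤ 2 * ‖x‖ ^ 2 + 2 * ‖y‖ ^ 2 := by
  nlinarith [parallelogram_law_with_norm ℝ x y, sq_nonneg ‖x - y‖]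

/-- One step of the momentum-corrected (STORM) recursion: the mean square error contracts, up to
the minibatch noise. -/
lemma storm_step {B : ℕ} (hB : 0 < B) {a : ℝ} (ha₀ : 0 ≤ a) (ha₁ : a ≤ 1) (u mn mo : V)
    (qn qo : ι → V) (hn : ∑ i, (qn i - mn) = 0) (ho : ∑ i, (qo i - mo) = 0) {ν D : ℝ}
    (hν : (𝔼 i, ‖qn i - mn‖ ^ 2) ≤ ν) (hD : (𝔼 i, ‖qn i - qo i‖ ^ 2) ≤ D) :
    (𝔼 b : Fin B → ι, ‖(1 - a) • u + a • ((B : ℝ)⁻¹ • ∑ k, qn (b k))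
        + (1 - a) • ((B : ℝ)⁻¹ • ∑ k, qn (b k) - (B : ℝ)⁻¹ • ∑ k, qo (b k)) - mn‖ ^ 2)
      ≤ (1 - a) * ‖u - mo‖ ^ 2 + (B : ℝ)⁻¹ * (2 * a ^ 2 * ν + 2 * D) := by
  -- `ξ` is the noise of a single sample. It is centred, and the new error is `(1 - a)` times the
  -- old error plus the minibatch mean of `ξ`.
  set ξ : ι → V := fun i => (qn i - mn) - (1 - a) • (qo i - mo) with hξ
  have hξ0 : ∑ i, ξ i = 0 := by
    simp only [hξ, Finset.sum_sub_distrib (f := fun i => qn i - mn), ← Finset.smul_sum, hn, ho]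
    simp
  have hsplit : ∀ b : Fin B → ι, (1 - a) • u + a • ((B : ℝ)⁻¹ • ∑ k, qn (b k))
        + (1 - a) • ((B : ℝ)⁻¹ • ∑ k, qn (b k) - (B : ℝ)⁻¹ • ∑ k, qo (b k)) - mn
      = (1 - a) • (u - mo) + (B : ℝ)⁻¹ • ∑ k, ξ (b k) := by
    intro b
    have : (B : ℝ)⁻¹ • ∑ k, ξ (b k) = ((B : ℝ)⁻¹ • ∑ k, qn (b k) - mn)
        - (1 - a) • ((B : ℝ)⁻¹ • ∑ k, qo (b k) - mo) := by
      rw [batch_sub hB qn, batch_sub hB qo, smul_comm (1 - a), ← smul_sub, Finset.smul_sum (r := 1 - a),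
        ← Finset.sum_sub_distrib]
    rw [this]
    module
  have hcross : (𝔼 b : Fin B → ι, inner ℝ ((1 - a) • (u - mo)) ((B : ℝ)⁻¹ • ∑ k, ξ (b k)))
      = 0 := by
    simp_rw [inner_smul_right _ _ (B : ℝ)⁻¹, inner_sum]
    rw [← Finset.mul_expect, Finset.expect_sum_comm]
    refine mul_eq_zero_of_right _ (Finset.sum_eq_zero fun k _ => ?_)
    rw [expect_apply_coord k fun i => inner ℝ ((1 - a) • (u - mo)) (ξ i),
      Fintype.expect_eq_sum_div_card, ← inner_sum, hξ0, inner_zero_right, zero_div]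
  have hnoise : (𝔼 i, ‖ξ i‖ ^ 2) ≤ 2 * a ^ 2 * ν + 2 * D := by
    have h1 : ∀ i, ‖ξ i‖ ^ 2
        ≤ 2 * a ^ 2 * ‖qn i - mn‖ ^ 2 + 2 * ‖(qn i - qo i) - (mn - mo)‖ ^ 2 := by
      intro i
      -- Regrouped so that both parts are small: the first carries the factor `a`, the second only
      -- sees the change between the two points.
      have : ξ i = a • (qn i - mn) + (1 - a) • ((qn i - qo i) - (mn - mo)) := by
        simp only [hξ]; module
      rw [this]
      refine (norm_add_sq_le_two _ _).trans ?_
      rw [norm_smul, norm_smul, mul_pow, mul_pow, Real.norm_eq_abs, Real.norm_eq_abs, sq_abs,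
        sq_abs]
      have : (1 - a) ^ 2 ≤ 1 := by nlinarith
      nlinarith [mul_le_mul_of_nonneg_right this (sq_nonneg ‖(qn i - qo i) - (mn - mo)‖)]
    have h2 : (𝔼 i, ‖(qn i - qo i) - (mn - mo)‖ ^ 2) ≤ D := by
      refine (expect_norm_sub_sq_le (fun i => qn i - qo i) (mn - mo) ?_).trans hD
      rw [← sub_self (0 : V)]
      nth_rewrite 1 [← hn]
      rw [← ho, ← Finset.sum_sub_distrib]
      exact Finset.sum_congr rfl fun i _ => by abel
    refine (expect_mono h1).trans ?_
    rw [Finset.expect_add_distrib, ← Finset.mul_expect, ← Finset.mul_expect]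
    gcongr
  have hexp : (𝔼 b : Fin B → ι, ‖(1 - a) • (u - mo) + (B : ℝ)⁻¹ • ∑ k, ξ (b k)‖ ^ 2)
      = (1 - a) ^ 2 * ‖u - mo‖ ^ 2 + (B : ℝ)⁻¹ * 𝔼 i, ‖ξ i‖ ^ 2 := by
    simp_rw [norm_add_sq_real]
    rw [Finset.expect_add_distrib, Finset.expect_add_distrib, Fintype.expect_const,
      ← Finset.mul_expect, hcross, expect_norm_sq_batch hB ξ hξ0, norm_smul, mul_pow,
      Real.norm_eq_abs, sq_abs]
    ring
  simp_rw [hsplit]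
  rw [hexp]
  -- One factor `1 - a` suffices for the contraction; the other is given up.
  have : (1 - a) ^ 2 ≤ 1 - a := by nlinarith
  gcongr

end InnerProduct

/-! ### Averages of vectors -/

section Average

variable {V : Type*} [NormedAddCommGroup V] [NormedSpace ℝ V]

lemma sum_sub_average_eq_zero {n : ℕ} (hn : 0 < n) (q : Fin n → V) :
    ∑ i, (q i - (n : ℝ)⁻¹ • ∑ i, q i) = 0 := by
  have : (n : ℝ) ≠ 0 := by positivity
  rw [Finset.sum_sub_distrib, Finset.sum_const, Finset.card_univ, Fintype.card_fin,
    ← Nat.cast_smul_eq_nsmul ℝ, smul_inv_smul₀ this, sub_self]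

lemma norm_average_le {n : ℕ} (hn : 0 < n) (q : Fin n → V) {M : ℝ} (h : ∀ i, ‖q i‖ ≤ M) :
    ‖(n : ℝ)⁻¹ • ∑ i, q i‖ ≤ M := by
  have hn' : (0 : ℝ) < n := by positivity
  rw [norm_smul, Real.norm_of_nonneg (by positivity), inv_mul_le_iff₀ hn']
  refine (norm_sum_le _ _).trans ((Finset.sum_le_sum fun i _ => h i).trans ?_)
  simp

lemma average_sub_average {n : ℕ} (q r : Fin n → V) :
    (n : ℝ)⁻¹ • ∑ i, q i - (n : ℝ)⁻¹ • ∑ i, r i = (n : ℝ)⁻¹ • ∑ i, (q i - r i) := by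
  rw [← smul_sub, Finset.sum_sub_distrib]

end Average

variable {d l n m : ℕ}

/-! ### The Frobenius norm as a Hilbert space norm -/

noncomputable section

/-- The entries of a matrix as a vector, whose Euclidean norm is the Frobenius norm. -/
def frobVec : Jac d l →ₗ[ℝ] EuclideanSpace ℝ (Fin l × Fin d) where
  toFun A := WithLp.toLp 2 fun ik => A (EuclideanSpace.single ik.2 (1 : ℝ)) ik.1
  map_add' A B := by ext; simp
  map_smul' r A := by ext; simp

end

lemma norm_frobVec (A : Jac d l) : ‖frobVec A‖ = frobNorm A := by
  rw [EuclideanSpace.norm_eq, frobNorm, Fintype.sum_prod_type]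
  simp [frobVec]

lemma frobNorm_nonneg (A : Jac d l) : 0 ≤ frobNorm A := Real.sqrt_nonneg _

/-- Cauchy–Schwarz in each row of the matrix. -/
lemma norm_le_frobNorm (A : Jac d l) : ‖A‖ ≤ frobNorm A := by
  refine A.opNorm_le_bound (frobNorm_nonneg A) fun v => ?_
  have hv : v = ∑ k, v k • EuclideanSpace.single k (1 : ℝ) := by
    ext j
    simp [Finset.sum_apply, Pi.single_apply]
  have hA : ∀ i, A v i = ∑ k, A (EuclideanSpace.single k (1 : ℝ)) i * v k := by
    intro i
    conv_lhs => rw [hv]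
    simp [map_sum, mul_comm]
  rw [EuclideanSpace.norm_eq, EuclideanSpace.norm_eq v, frobNorm, ← Real.sqrt_mul (by positivity)]
  refine Real.sqrt_le_sqrt ?_
  rw [Finset.sum_mul]
  refine Finset.sum_le_sum fun i _ => ?_
  simp only [Real.norm_eq_abs, sq_abs]
  rw [hA]
  exact Finset.sum_mul_sq_le_sq_mul_sq _ _ _

/-! ### Gradients of the averaged functions -/

lemma hasGradientAt_outerFun {f : Fin n → Vec l → ℝ} (hf : ∀ i, Differentiable ℝ (f i))
    (y : Vec l) :
    HasGradientAt (outerFun f) ((n : ℝ)⁻¹ • ∑ i, gradient (f i) y) y := by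
  rw [hasGradientAt_iff_hasFDerivAt, map_smul, map_sum]
  have : HasFDerivAt (fun y => ∑ i, f i y)
      (∑ i, (InnerProductSpace.toDual ℝ (Vec l)) (gradient (f i) y)) y :=
    HasFDerivAt.fun_sum fun i _ => ((hf i y).hasGradientAt).hasFDerivAt
  exact this.const_mul _

lemma gradient_outerFun {f : Fin n → Vec l → ℝ} (hf : ∀ i, Differentiable ℝ (f i)) (y : Vec l) :
    gradient (outerFun f) y = (n : ℝ)⁻¹ • ∑ i, gradient (f i) y :=
  (hasGradientAt_outerFun hf y).gradient

lemma hasFDerivAt_innerFun {g : Fin m → Vec d → Vec l} (hg : ∀ j, Differentiable ℝ (g j))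
    (x : Vec d) :
    HasFDerivAt (innerFun g) ((m : ℝ)⁻¹ • ∑ j, fderiv ℝ (g j) x) x := by
  have : HasFDerivAt (fun x => ∑ j, g j x) (∑ j, fderiv ℝ (g j) x) x :=
    HasFDerivAt.fun_sum fun j _ => (hg j x).hasFDerivAt
  exact this.const_smul (m : ℝ)⁻¹

lemma fderiv_innerFun {g : Fin m → Vec d → Vec l} (hg : ∀ j, Differentiable ℝ (g j))
    (x : Vec d) :
    fderiv ℝ (innerFun g) x = (m : ℝ)⁻¹ • ∑ j, fderiv ℝ (g j) x :=
  (hasFDerivAt_innerFun hg x).fderiv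

lemma hasGradientAt_objective {f : Fin n → Vec l → ℝ} {g : Fin m → Vec d → Vec l}
    (hf : ∀ i, Differentiable ℝ (f i)) (hg : ∀ j, Differentiable ℝ (g j)) (x : Vec d) :
    HasGradientAt (objective f g)
      ((fderiv ℝ (innerFun g) x).adjoint (gradient (outerFun f) (innerFun g x))) x := by
  rw [hasGradientAt_iff_hasFDerivAt]
  have h1 := (hasGradientAt_outerFun hf (innerFun g x)).differentiableAt.hasGradientAt.hasFDerivAt
  have h2 := (hasFDerivAt_innerFun hg x).differentiableAt.hasFDerivAt
  refine (show HasFDerivAt (objective f g) _ x from h1.comp x h2).congr_fderiv ?_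
  ext v
  simp [ContinuousLinearMap.adjoint_inner_left, -toDual_gradient, -inner_gradient_left]

lemma gradient_objective {f : Fin n → Vec l → ℝ} {g : Fin m → Vec d → Vec l}
    (hf : ∀ i, Differentiable ℝ (f i)) (hg : ∀ j, Differentiable ℝ (g j)) (x : Vec d) :
    gradient (objective f g) x
      = (fderiv ℝ (innerFun g) x).adjoint (gradient (outerFun f) (innerFun g x)) :=
  (hasGradientAt_objective hf hg x).gradient

/-- `Aᵀv` is bilinear in `A` and `v`, so the two averages can be pulled out. In this form the
Lipschitz hypothesis on the individual products passes to `∇Φ` with the same constant `LΦ`. -/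
lemma gradient_objective_eq_average {f : Fin n → Vec l → ℝ} {g : Fin m → Vec d → Vec l}
    (hf : ∀ i, Differentiable ℝ (f i)) (hg : ∀ j, Differentiable ℝ (g j)) (x : Vec d) :
    gradient (objective f g) x = (m : ℝ)⁻¹ • ∑ j, (n : ℝ)⁻¹ • ∑ i,
      (fderiv ℝ (g j) x).adjoint (gradient (f i) (innerFun g x)) := by
  rw [gradient_objective hf hg, fderiv_innerFun hg, gradient_outerFun hf]
  refine ext_inner_right ℝ fun v => ?_
  simp only [ContinuousLinearMap.adjoint_inner_left, inner_smul_left, sum_inner, inner_smul_right,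
    inner_sum, smul_apply, sum_apply, conj_trivial, Finset.mul_sum]

/-! ### Consequences of the assumptions -/

section Consequences

variable {κ : Constants} {f : Fin n → Vec l → ℝ} {g : Fin m → Vec d → Vec l} {x₀ : Vec d}

lemma Assumptions.fderiv_sub_le (h : Assumptions κ f g x₀) (j : Fin m) (x x' : Vec d) :
    ‖fderiv ℝ (g j) x - fderiv ℝ (g j) x'‖ ≤ κ.Lg * ‖x - x'‖ :=
  (norm_le_frobNorm _).trans (h.lipschitz_jacobian j x x')

lemma Assumptions.inner_sub_le (h : Assumptions κ f g x₀) (j : Fin m) (x x' : Vec d) :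
    ‖g j x - g j x'‖ ≤ κ.Mg * ‖x - x'‖ :=
  convex_univ.norm_image_sub_le_of_norm_fderiv_le (fun z _ => h.differentiable_g j z)
    (fun z _ => h.bound_jacobian j z) (Set.mem_univ _) (Set.mem_univ _)

lemma Assumptions.norm_fderiv_innerFun_le (h : Assumptions κ f g x₀) (hm : 0 < m) (x : Vec d) :
    ‖fderiv ℝ (innerFun g) x‖ ≤ κ.Mg := by
  rw [fderiv_innerFun h.differentiable_g]
  exact norm_average_le hm _ fun j => h.bound_jacobian j x

lemma Assumptions.norm_gradient_outerFun_le (h : Assumptions κ f g x₀) (hn : 0 < n) (y : Vec l) :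
    ‖gradient (outerFun f) y‖ ≤ κ.Mf := by
  rw [gradient_outerFun h.differentiable_f]
  exact norm_average_le hn _ fun j => h.bound_gradient j y

lemma Assumptions.gradient_outerFun_sub_le (h : Assumptions κ f g x₀) (hn : 0 < n)
    (y y' : Vec l) :
    ‖gradient (outerFun f) y - gradient (outerFun f) y'‖ ≤ κ.Lf * ‖y - y'‖ := by
  rw [gradient_outerFun h.differentiable_f, gradient_outerFun h.differentiable_f,
    average_sub_average]
  exact norm_average_le hn _ fun j => h.lipschitz_gradient j y y'

lemma Assumptions.gradient_objective_sub_le (h : Assumptions κ f g x₀) (hn : 0 < n) (hm : 0 < m)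
    (x x' : Vec d) :
    ‖gradient (objective f g) x - gradient (objective f g) x'‖ ≤ κ.LΦ * ‖x - x'‖ := by
  rw [gradient_objective_eq_average h.differentiable_f h.differentiable_g,
    gradient_objective_eq_average h.differentiable_f h.differentiable_g, average_sub_average]
  refine norm_average_le hm _ fun j => ?_
  rw [average_sub_average]
  exact norm_average_le hn _ fun i => h.lipschitz_composite i j x x'

end Consequences

/-! ### The descent inequality for functions with a Lipschitz gradient -/

lemma descent_inequality {E : Type*} [NormedAddCommGroup E] [InnerProductSpace ℝ E]
    [CompleteSpace E] {φ : E → ℝ} {L : ℝ} (hφ : Differentiable ℝ φ)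
    (hL : ∀ x y, ‖gradient φ x - gradient φ y‖ ≤ L * ‖x - y‖) (x v : E) :
    φ (x + v) ≤ φ x + inner ℝ (gradient φ x) v + L / 2 * ‖v‖ ^ 2 := by
  -- `h` is the quadratic upper model minus `φ` along the segment, up to the constant `φ x`. The
  -- Lipschitz bound makes its derivative nonnegative on `[0, 1]`, and `h 0 ≤ h 1` is the claim.
  set h : ℝ → ℝ := fun t =>
    t * inner ℝ (gradient φ x) v + L / 2 * ‖v‖ ^ 2 * t ^ 2 - φ (x + t • v) with hh
  have hline : ∀ t : ℝ, HasDerivAt (fun t : ℝ => φ (x + t • v))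
      (inner ℝ (gradient φ (x + t • v)) v) t := by
    intro t
    have h1 : HasDerivAt (fun t : ℝ => x + t • v) v t := by
      simpa using ((hasDerivAt_id t).smul_const v).const_add x
    have h2 := (hφ (x + t • v)).hasFDerivAt.comp_hasDerivAt t h1
    rwa [← inner_gradient_left] at h2
  have hderiv : ∀ t, HasDerivAt h (inner ℝ (gradient φ x) v + L * ‖v‖ ^ 2 * t
      - inner ℝ (gradient φ (x + t • v)) v) t := by
    intro t
    have h1 := ((hasDerivAt_id t).mul_const (inner ℝ (gradient φ x) v)).add
      ((hasDerivAt_pow 2 t).const_mul (L / 2 * ‖v‖ ^ 2))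
    refine (h1.sub (hline t)).congr_deriv ?_
    norm_num
    ring
  have hmono : MonotoneOn h (Set.Icc 0 1) := by
    refine monotoneOn_of_deriv_nonneg (convex_Icc 0 1)
      (fun t _ => (hderiv t).continuousAt.continuousWithinAt)
      (fun t _ => (hderiv t).differentiableAt.differentiableWithinAt) fun t ht => ?_
    rw [interior_Icc] at ht
    rw [(hderiv t).deriv]
    have h1 : inner ℝ (gradient φ (x + t • v) - gradient φ x) v ≤ L * ‖v‖ ^ 2 * t := by
      refine (real_inner_le_norm _ _).trans ?_
      have := hL (x + t • v) x
      rw [add_sub_cancel_left, norm_smul, Real.norm_of_nonneg ht.1.le] at this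
      calc _ ≤ L * (t * ‖v‖) * ‖v‖ := by gcongr
        _ = _ := by ring
    rw [inner_sub_left] at h1
    linarith
  have := hmono (Set.left_mem_Icc.2 zero_le_one) (Set.right_mem_Icc.2 zero_le_one) zero_le_one
  simp only [hh, zero_mul, zero_smul, add_zero, one_smul, one_mul] at this
  norm_num [-inner_gradient_left] at this
  linarith

/-! ### The trajectory of the algorithm -/

/-- The minibatches of a run. -/
abbrev Batches (n m : ℕ) (p : Params) : Type :=
  StartBatch n m p × (Fin (p.T + 1) → StepBatch n m p)

noncomputable section

/-- The states visited by the algorithm, without the counting of oracle calls. -/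
def trajectory (O : Oracle d l n m) (p : Params) (x₀ : Vec d) (b : Batches n m p) :
    ℕ → State d l
  | 0 => (start O p x₀ b.1).val
  | t + 1 => (step O p (trajectory O p x₀ b t) (b.2 (Fin.ofNat (p.T + 1) t))).val

end

lemma bind_val {α β : Type} (c : Counted α) (k : α → Counted β) :
    (c >>= k).val = (k c.val).val := rfl

lemma iterate_val (O : Oracle d l n m) (p : Params) (x₀ : Vec d) (ω : Randomness n m p) (t : ℕ) :
    (iterate O p x₀ ω t).val = trajectory O p x₀ (ω.1, ω.2.1) t := by
  induction t with
  | zero => rfl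
  | succ t ih =>
    rw [iterate, trajectory, bind_val, ih]

/-- The state at time `t` has only used the minibatches with index below `t`. -/
lemma trajectory_update (O : Oracle d l n m) (p : Params) (x₀ : Vec d) (b₀ : StartBatch n m p)
    (bs : Fin (p.T + 1) → StepBatch n m p) (i : Fin (p.T + 1)) (b : StepBatch n m p) {t : ℕ}
    (ht : t ≤ i) :
    trajectory O p x₀ (b₀, Function.update bs i b) t = trajectory O p x₀ (b₀, bs) t := by
  induction t with
  | zero => rfl
  | succ t ih =>
    have hne : Fin.ofNat (p.T + 1) t ≠ i := by
      intro h
      have := congrArg Fin.val h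
      rw [Fin.val_ofNat, Nat.mod_eq_of_lt (by omega)] at this
      omega
    simp only [trajectory]
    rw [ih (by omega), Function.update_of_ne hne]

instance [NeZero n] [NeZero m] (p : Params) : Nonempty (StepBatch n m p) :=
  ⟨fun _ => 0, fun _ => 0, fun _ => 0⟩

instance [NeZero n] [NeZero m] (p : Params) : Nonempty (Batches n m p) :=
  ⟨(fun _ => 0, fun _ => 0, fun _ => 0), fun _ => Classical.arbitrary _⟩

/-- The minibatches of an iteration are independent of the state from which it starts. -/
lemma expect_trajectory_succ [NeZero n] [NeZero m] (O : Oracle d l n m) (p : Params)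
    (x₀ : Vec d) {t : ℕ} (ht : t ≤ p.T) (ψ : State d l → ℝ) :
    (𝔼 b, ψ (trajectory O p x₀ b (t + 1)))
      = 𝔼 b, 𝔼 b', ψ (step O p (trajectory O p x₀ b t) b').val := by
  refine (expect_prod _).trans (Eq.trans ?_ (expect_prod _).symm)
  refine Finset.expect_congr rfl fun b₀ _ => ?_
  have hval : ((Fin.ofNat (p.T + 1) t : Fin (p.T + 1)) : ℕ) = t := by
    rw [Fin.val_ofNat, Nat.mod_eq_of_lt (by omega)]
  simp only [trajectory]
  generalize Fin.ofNat (p.T + 1) t = i at hval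
  -- Redraw the minibatch of this iteration; by `trajectory_update` the state from which it starts
  -- does not notice.
  refine (expect_resample i _).trans ?_
  refine Finset.expect_congr rfl fun bs _ => Finset.expect_congr rfl fun b' _ => ?_
  rw [trajectory_update O p x₀ b₀ bs _ b' hval.ge, Function.update_self]

/-! ### The estimators computed with the incremental first-order oracle -/

section Estimators

variable (f : Fin n → Vec l → ℝ) (g : Fin m → Vec d → Vec l) (p : Params)

lemma ifo_meanValue {B : ℕ} (b : Fin B → Fin m) (x : Vec d) :
    ((ifo f g).meanValue b x).val = (B : ℝ)⁻¹ • ∑ k, g (b k) x := rfl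

lemma ifo_meanJacobian {B : ℕ} (b : Fin B → Fin m) (x : Vec d) :
    ((ifo f g).meanJacobian b x).val = (B : ℝ)⁻¹ • ∑ k, fderiv ℝ (g (b k)) x := rfl

lemma ifo_meanGradient {B : ℕ} (b : Fin B → Fin n) (y : Vec l) :
    ((ifo f g).meanGradient b y).val = (B : ℝ)⁻¹ • ∑ k, gradient (f (b k)) y := rfl

variable (s : State d l) (b : StepBatch n m p) (O : Oracle d l n m)

lemma step_x : (step O p s b).val.x = nextPoint p s := rfl

lemma step_g : (step O p s b).val.g = (1 - p.ag) • s.g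
    + p.ag • (O.meanValue b.1 (nextPoint p s)).val
    + (1 - p.ag) • ((O.meanValue b.1 (nextPoint p s)).val - (O.meanValue b.1 s.x).val) := rfl

lemma step_G : (step O p s b).val.G = (1 - p.aJ) • s.G
    + p.aJ • (O.meanJacobian b.2.1 (nextPoint p s)).val
    + (1 - p.aJ) • ((O.meanJacobian b.2.1 (nextPoint p s)).val
      - (O.meanJacobian b.2.1 s.x).val) := rfl

lemma step_F : (step O p s b).val.F = (1 - p.aΦ) • s.F
    + p.aΦ • (step O p s b).val.G.adjoint (O.meanGradient b.2.2 (step O p s b).val.g).val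
    + (1 - p.aΦ) • ((step O p s b).val.G.adjoint
        (O.meanGradient b.2.2 (step O p s b).val.g).val
      - s.G.adjoint (O.meanGradient b.2.2 s.g).val) := rfl

end Estimators

lemma norm_nextPoint_sub_le {p : Params} (hη : 0 ≤ p.η) (hε : 0 ≤ p.ε) (s : State d l) :
    ‖nextPoint p s - s.x‖ ≤ p.η * p.ε := by
  simp only [nextPoint, add_sub_cancel_left, sub_sub_cancel_left, norm_neg]
  rw [norm_smul, norm_neg, Real.norm_of_nonneg (by positivity)]
  rcases eq_or_ne ‖p.η • s.F‖ 0 with h | h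
  · rw [h, mul_zero]; positivity
  · calc _ ≤ p.η * p.ε / ‖p.η • s.F‖ * ‖p.η • s.F‖ := by gcongr; exact min_le_left _ _
      _ = _ := div_mul_cancel₀ _ h

lemma batch_smul_le {B : ℕ} (hB : 0 < B) {r M : ℝ} (h : r ≤ M) (hM : 0 ≤ M) :
    (B : ℝ)⁻¹ * r ≤ M := by
  have : (B : ℝ)⁻¹ ≤ 1 := inv_le_one_of_one_le₀ (by exact_mod_cast hB)
  have h0 : 0 ≤ (B : ℝ)⁻¹ := by positivity
  nlinarith

/-! ### One-step error bounds -/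

noncomputable section

/-- Squared error of the estimator of `g(x)`. -/
def valueError (g : Fin m → Vec d → Vec l) (s : State d l) : ℝ :=
  ‖s.g - innerFun g s.x‖ ^ 2

/-- Squared error of the estimator of `∂g(x)`. -/
def jacobianError (g : Fin m → Vec d → Vec l) (s : State d l) : ℝ :=
  frobNorm (s.G - fderiv ℝ (innerFun g) s.x) ^ 2

/-- Squared error of `𝑭` as an estimator of `𝑮ᵀ ∇f(𝒈)`. -/
def outerError (f : Fin n → Vec l → ℝ) (s : State d l) : ℝ :=
  ‖s.F - s.G.adjoint (gradient (outerFun f) s.g)‖ ^ 2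

/-- Squared error of `𝑭` as an estimator of `∇Φ(x)`. -/
def totalError (f : Fin n → Vec l → ℝ) (g : Fin m → Vec d → Vec l) (s : State d l) : ℝ :=
  ‖s.F - gradient (objective f g) s.x‖ ^ 2

end

section OneStep

variable {κ : Constants} {f : Fin n → Vec l → ℝ} {g : Fin m → Vec d → Vec l} {x₀ : Vec d}
  {p : Params}

lemma norm_add_add_sq_le {V : Type*} [NormedAddCommGroup V] (x y z : V) :
    ‖x + y + z‖ ^ 2 ≤ 3 * ‖x‖ ^ 2 + 3 * ‖y‖ ^ 2 + 3 * ‖z‖ ^ 2 := by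
  have h := norm_add₃_le (a := x) (b := y) (c := z)
  have := norm_nonneg (x + y + z)
  nlinarith [sq_nonneg (‖x‖ - ‖y‖), sq_nonneg (‖x‖ - ‖z‖), sq_nonneg (‖y‖ - ‖z‖),
    mul_self_le_mul_self this h]

/-- The movement of the estimator equals `-a (u - mo)`, plus `a` times the minibatch error at the
old point, plus the minibatch mean of `qn - qo`. The outer recursion needs this because it compares
gradients of `f` at consecutive estimates rather than at consecutive exact values. -/
lemma storm_increment {ι V : Type*} [Fintype ι] [Nonempty ι] [NormedAddCommGroup V]
    [InnerProductSpace ℝ V] {B : ℕ} (hB : 0 < B) (a : ℝ) (u mo : V) (qn qo : ι → V)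
    (ho : ∑ i, (qo i - mo) = 0) {ν D : ℝ} (hν : (𝔼 i, ‖qo i - mo‖ ^ 2) ≤ ν)
    (hD : ∀ i, ‖qn i - qo i‖ ≤ D) :
    (𝔼 b : Fin B → ι, ‖(1 - a) • u + a • ((B : ℝ)⁻¹ • ∑ k, qn (b k))
        + (1 - a) • ((B : ℝ)⁻¹ • ∑ k, qn (b k) - (B : ℝ)⁻¹ • ∑ k, qo (b k)) - u‖ ^ 2)
      ≤ 3 * (a ^ 2 * ‖u - mo‖ ^ 2 + a ^ 2 * ν + D ^ 2) := by
  have hpt : ∀ b : Fin B → ι, ‖(1 - a) • u + a • ((B : ℝ)⁻¹ • ∑ k, qn (b k))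
        + (1 - a) • ((B : ℝ)⁻¹ • ∑ k, qn (b k) - (B : ℝ)⁻¹ • ∑ k, qo (b k)) - u‖ ^ 2
      ≤ (3 * (a ^ 2 * ‖u - mo‖ ^ 2) + 3 * D ^ 2)
        + 3 * a ^ 2 * ‖(B : ℝ)⁻¹ • ∑ k, (qo (b k) - mo)‖ ^ 2 := by
    intro b
    have h2 : (1 - a) • u + a • ((B : ℝ)⁻¹ • ∑ k, qn (b k))
        + (1 - a) • ((B : ℝ)⁻¹ • ∑ k, qn (b k) - (B : ℝ)⁻¹ • ∑ k, qo (b k)) - u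
        = (-a) • (u - mo) + a • ((B : ℝ)⁻¹ • ∑ k, (qo (b k) - mo))
          + (B : ℝ)⁻¹ • ∑ k, (qn (b k) - qo (b k)) := by
      rw [← batch_sub hB qo, ← average_sub_average]
      module
    have h3 := norm_average_le hB (fun k => qn (b k) - qo (b k)) fun k => hD (b k)
    rw [h2]
    refine (norm_add_add_sq_le _ _ _).trans ?_
    rw [norm_smul, norm_smul, mul_pow, mul_pow, Real.norm_eq_abs, Real.norm_eq_abs, sq_abs,
      sq_abs]
    have := pow_le_pow_left₀ (norm_nonneg _) h3 2
    linarith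
  refine (expect_mono hpt).trans ?_
  have hν0 : 0 ≤ ν := (Finset.expect_nonneg fun i _ => by positivity).trans hν
  have h4 : (B : ℝ)⁻¹ * (𝔼 i, ‖qo i - mo‖ ^ 2) ≤ ν := batch_smul_le hB hν hν0
  rw [expect_const_add, ← Finset.mul_expect, expect_norm_sq_batch hB (fun i => qo i - mo) ho]
  nlinarith [mul_le_mul_of_nonneg_left h4 (sq_nonneg a)]

/-- The new `G` is `(1 - a) G` plus `a` times a mean of Jacobians plus a drift of size at most `Lg η
ε`. The condition `hΓ` says that the shrinkage by `a` pays for both, so the ball of radius `Γ` is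
invariant for every minibatch. -/
lemma norm_step_G_le (h : Assumptions κ f g x₀) (hη : 0 ≤ p.η) (hε : 0 ≤ p.ε)
    (hLg : 0 ≤ κ.Lg) (ha : p.aJ ∈ Set.Ioo (0 : ℝ) 1) (hB : 0 < p.BJ) {Γ : ℝ}
    (hΓ : p.aJ * κ.Mg + κ.Lg * (p.η * p.ε) ≤ p.aJ * Γ) (s : State d l) (hs : ‖s.G‖ ≤ Γ)
    (b : StepBatch n m p) : ‖(step (ifo f g) p s b).val.G‖ ≤ Γ := by
  have h0 := ha.1.le
  have h1 : 0 ≤ 1 - p.aJ := by linarith [ha.2]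
  have hx := norm_nextPoint_sub_le hη hε s
  rw [step_G, ifo_meanJacobian, ifo_meanJacobian, average_sub_average]
  have hJ := norm_average_le hB _ fun k => h.bound_jacobian (b.2.1 k) (nextPoint p s)
  have hD : ‖(p.BJ : ℝ)⁻¹ • ∑ k, (fderiv ℝ (g (b.2.1 k)) (nextPoint p s)
      - fderiv ℝ (g (b.2.1 k)) s.x)‖ ≤ κ.Lg * (p.η * p.ε) :=
    norm_average_le hB _ fun k => (h.fderiv_sub_le _ _ _).trans (by gcongr)
  refine (norm_add₃_le).trans ?_
  rw [norm_smul (1 - p.aJ), norm_smul p.aJ, norm_smul (1 - p.aJ), Real.norm_of_nonneg h0,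
    Real.norm_of_nonneg h1]
  have h2 := mul_le_mul_of_nonneg_left hJ h0
  have h3 := mul_le_mul_of_nonneg_left hD h1
  have h4 := mul_le_mul_of_nonneg_left hs h1
  have h5 : 0 ≤ p.aJ * (κ.Lg * (p.η * p.ε)) := by positivity
  nlinarith

variable [NeZero n] [NeZero m]

lemma expect_fst {α β γ : Type*} [Fintype α] [Fintype β] [Fintype γ] [Nonempty β] [Nonempty γ]
    (F : α → ℝ) : (𝔼 b : α × β × γ, F b.1) = 𝔼 a, F a := by
  rw [expect_prod]
  simp_rw [Fintype.expect_const]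

lemma expect_snd {α β γ : Type*} [Fintype α] [Fintype β] [Fintype γ] [Nonempty α] [Nonempty γ]
    (F : β → ℝ) : (𝔼 b : α × β × γ, F b.2.1) = 𝔼 a, F a := by
  rw [expect_prod]
  simp_rw [expect_prod, Fintype.expect_const]

lemma sum_value_sub (g : Fin m → Vec d → Vec l) (x : Vec d) :
    ∑ j, (g j x - innerFun g x) = 0 :=
  sum_sub_average_eq_zero (NeZero.pos m) fun j => g j x

lemma sum_frobVec_sub (hg : ∀ j, Differentiable ℝ (g j)) (x : Vec d) :
    ∑ j, (frobVec (fderiv ℝ (g j) x) - frobVec (fderiv ℝ (innerFun g) x)) = 0 := by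
  simp_rw [← map_sub, ← map_sum]
  rw [fderiv_innerFun hg, sum_sub_average_eq_zero (NeZero.pos m), map_zero]

lemma sum_adjoint_gradient_sub (hf : ∀ i, Differentiable ℝ (f i)) (G : Jac d l) (y : Vec l) :
    ∑ i, (G.adjoint (gradient (f i) y) - G.adjoint (gradient (outerFun f) y)) = 0 := by
  simp_rw [← map_sub, ← map_sum]
  rw [gradient_outerFun hf, sum_sub_average_eq_zero (NeZero.pos n), map_zero]

lemma expect_valueError_step (h : Assumptions κ f g x₀) (hη : 0 ≤ p.η) (hε : 0 ≤ p.ε)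
    (hMg : 0 ≤ κ.Mg) (ha : p.ag ∈ Set.Ioo (0 : ℝ) 1) (hB : 0 < p.Bg) (s : State d l) :
    (𝔼 b, valueError g (step (ifo f g) p s b).val) ≤ (1 - p.ag) * valueError g s
      + (p.Bg : ℝ)⁻¹ * (2 * p.ag ^ 2 * κ.H₃ + 2 * (κ.Mg * (p.η * p.ε)) ^ 2) := by
  simp only [valueError, step_g, step_x, ifo_meanValue]
  rw [expect_fst fun b : Fin p.Bg → Fin m => ‖(1 - p.ag) • s.g
    + p.ag • ((p.Bg : ℝ)⁻¹ • ∑ k, g (b k) (nextPoint p s))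
    + (1 - p.ag) • ((p.Bg : ℝ)⁻¹ • ∑ k, g (b k) (nextPoint p s)
      - (p.Bg : ℝ)⁻¹ • ∑ k, g (b k) s.x) - innerFun g (nextPoint p s)‖ ^ 2]
  refine storm_step hB ha.1.le ha.2.le _ _ _ (fun j => g j (nextPoint p s)) (fun j => g j s.x)
    (sum_value_sub _ _) (sum_value_sub _ _) (h.variance_value _) (expect_le_const fun j => ?_)
  have := norm_nextPoint_sub_le hη hε s
  exact pow_le_pow_left₀ (norm_nonneg _) ((h.inner_sub_le j _ _).trans (by gcongr)) 2

lemma expect_jacobianError_step (h : Assumptions κ f g x₀) (hη : 0 ≤ p.η) (hε : 0 ≤ p.ε)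
    (hLg : 0 ≤ κ.Lg) (ha : p.aJ ∈ Set.Ioo (0 : ℝ) 1) (hB : 0 < p.BJ) (s : State d l) :
    (𝔼 b, jacobianError g (step (ifo f g) p s b).val) ≤ (1 - p.aJ) * jacobianError g s
      + (p.BJ : ℝ)⁻¹ * (2 * p.aJ ^ 2 * κ.H₂ + 2 * (κ.Lg * (p.η * p.ε)) ^ 2) := by
  simp only [jacobianError, step_G, step_x, ifo_meanJacobian, ← norm_frobVec, map_sub, map_add,
    map_smul, map_sum]
  rw [expect_snd fun b : Fin p.BJ → Fin m => ‖(1 - p.aJ) • frobVec s.G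
    + p.aJ • ((p.BJ : ℝ)⁻¹ • ∑ k, frobVec (fderiv ℝ (g (b k)) (nextPoint p s)))
    + (1 - p.aJ) • ((p.BJ : ℝ)⁻¹ • ∑ k, frobVec (fderiv ℝ (g (b k)) (nextPoint p s))
      - (p.BJ : ℝ)⁻¹ • ∑ k, frobVec (fderiv ℝ (g (b k)) s.x))
    - frobVec (fderiv ℝ (innerFun g) (nextPoint p s))‖ ^ 2]
  have hvar : ∀ x, (𝔼 j, ‖frobVec (fderiv ℝ (g j) x) - frobVec (fderiv ℝ (innerFun g) x)‖ ^ 2)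
      ≤ κ.H₂ := by
    intro x
    simp_rw [← map_sub, norm_frobVec]
    exact h.variance_jacobian x
  refine storm_step hB ha.1.le ha.2.le _ _ _ (fun j => frobVec (fderiv ℝ (g j) (nextPoint p s)))
    (fun j => frobVec (fderiv ℝ (g j) s.x)) (sum_frobVec_sub h.differentiable_g _)
    (sum_frobVec_sub h.differentiable_g _) (hvar _) (expect_le_const fun j => ?_)
  have := norm_nextPoint_sub_le hη hε s
  rw [← map_sub, norm_frobVec]
  exact pow_le_pow_left₀ (frobNorm_nonneg _)
    ((h.lipschitz_jacobian j _ _).trans (by gcongr)) 2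

lemma expect_value_increment (h : Assumptions κ f g x₀) (hη : 0 ≤ p.η) (hε : 0 ≤ p.ε)
    (hMg : 0 ≤ κ.Mg) (hB : 0 < p.Bg) (s : State d l) :
    (𝔼 b, ‖(step (ifo f g) p s b).val.g - s.g‖ ^ 2) ≤ 3 * (p.ag ^ 2 * valueError g s
      + p.ag ^ 2 * κ.H₃ + (κ.Mg * (p.η * p.ε)) ^ 2) := by
  simp only [valueError, step_g, ifo_meanValue]
  rw [expect_fst fun b : Fin p.Bg → Fin m => ‖(1 - p.ag) • s.g
    + p.ag • ((p.Bg : ℝ)⁻¹ • ∑ k, g (b k) (nextPoint p s))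
    + (1 - p.ag) • ((p.Bg : ℝ)⁻¹ • ∑ k, g (b k) (nextPoint p s)
      - (p.Bg : ℝ)⁻¹ • ∑ k, g (b k) s.x) - s.g‖ ^ 2]
  have := norm_nextPoint_sub_le hη hε s
  exact storm_increment hB _ _ _ (fun j => g j (nextPoint p s)) (fun j => g j s.x)
    (sum_value_sub _ _) (h.variance_value _) fun j => (h.inner_sub_le j _ _).trans (by gcongr)

lemma expect_jacobian_increment (h : Assumptions κ f g x₀) (hη : 0 ≤ p.η) (hε : 0 ≤ p.ε)
    (hLg : 0 ≤ κ.Lg) (hB : 0 < p.BJ) (s : State d l) :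
    (𝔼 b, frobNorm ((step (ifo f g) p s b).val.G - s.G) ^ 2)
      ≤ 3 * (p.aJ ^ 2 * jacobianError g s + p.aJ ^ 2 * κ.H₂ + (κ.Lg * (p.η * p.ε)) ^ 2) := by
  simp only [jacobianError, step_G, ifo_meanJacobian, ← norm_frobVec, map_sub, map_add,
    map_smul, map_sum]
  rw [expect_snd fun b : Fin p.BJ → Fin m => ‖(1 - p.aJ) • frobVec s.G
    + p.aJ • ((p.BJ : ℝ)⁻¹ • ∑ k, frobVec (fderiv ℝ (g (b k)) (nextPoint p s)))
    + (1 - p.aJ) • ((p.BJ : ℝ)⁻¹ • ∑ k, frobVec (fderiv ℝ (g (b k)) (nextPoint p s))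
      - (p.BJ : ℝ)⁻¹ • ∑ k, frobVec (fderiv ℝ (g (b k)) s.x)) - frobVec s.G‖ ^ 2]
  have hvar : ∀ x, (𝔼 j, ‖frobVec (fderiv ℝ (g j) x) - frobVec (fderiv ℝ (innerFun g) x)‖ ^ 2)
      ≤ κ.H₂ := by
    intro x
    simp_rw [← map_sub, norm_frobVec]
    exact h.variance_jacobian x
  have := norm_nextPoint_sub_le hη hε s
  refine storm_increment hB _ _ _ (fun j => frobVec (fderiv ℝ (g j) (nextPoint p s)))
    (fun j => frobVec (fderiv ℝ (g j) s.x))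
    (sum_frobVec_sub h.differentiable_g _) (hvar _) fun j => ?_
  rw [← map_sub, norm_frobVec]
  exact (h.lipschitz_jacobian j _ _).trans (by gcongr)

end OneStep

/-! ### The recursion for `F` as an estimator of `Gᵀ∇f(g)`. -/

section OuterStep

variable {κ : Constants} {f : Fin n → Vec l → ℝ} {g : Fin m → Vec d → Vec l} {x₀ : Vec d}
  {p : Params}

lemma expect_redraw_last {α β γ : Type*} [Fintype α] [Fintype β] [Fintype γ] [Nonempty γ]
    (F : α × β × γ → ℝ) : (𝔼 b, F b) = 𝔼 b : α × β × γ, 𝔼 c, F (b.1, b.2.1, c) := by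
  refine (expect_prod _).trans (Eq.trans ?_ (expect_prod _).symm)
  refine Finset.expect_congr rfl fun a _ => ?_
  refine (expect_prod _).trans (Eq.trans ?_ (expect_prod _).symm)
  exact Finset.expect_congr rfl fun b _ => (Fintype.expect_const _).symm

lemma norm_adjoint_apply_le (A : Jac d l) (v : Vec l) : ‖A.adjoint v‖ ≤ ‖A‖ * ‖v‖ := by
  have := A.adjoint.le_opNorm v
  rwa [LinearIsometryEquiv.norm_map] at this

lemma norm_adjoint_sub_adjoint_le (A A' : Jac d l) (v v' : Vec l) :
    ‖A.adjoint v - A'.adjoint v'‖ ≤ ‖A - A'‖ * ‖v‖ + ‖A'‖ * ‖v - v'‖ := by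
  have : A.adjoint v - A'.adjoint v' = (A - A').adjoint v + A'.adjoint (v - v') := by
    rw [map_sub, map_sub, sub_apply]
    abel
  rw [this]
  exact (norm_add_le _ _).trans (add_le_add (norm_adjoint_apply_le _ _)
    (norm_adjoint_apply_le _ _))

lemma add_sq_le_two (x y : ℝ) : (x + y) ^ 2 ≤ 2 * x ^ 2 + 2 * y ^ 2 := by
  nlinarith [sq_nonneg (x - y)]

lemma expect_norm_adjoint_sub_sq_le (h : Assumptions κ f g x₀) {G : Jac d l} {Γ : ℝ}
    (hG : ‖G‖ ≤ Γ) (y : Vec l) :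
    (𝔼 i, ‖G.adjoint (gradient (f i) y) - G.adjoint (gradient (outerFun f) y)‖ ^ 2)
      ≤ Γ ^ 2 * κ.H₁ := by
  have hpt : ∀ i, ‖G.adjoint (gradient (f i) y) - G.adjoint (gradient (outerFun f) y)‖ ^ 2
      ≤ Γ ^ 2 * ‖gradient (f i) y - gradient (outerFun f) y‖ ^ 2 := by
    intro i
    rw [← map_sub, ← mul_pow]
    exact pow_le_pow_left₀ (norm_nonneg _) ((norm_adjoint_apply_le _ _).trans (by gcongr)) 2
  refine (expect_mono hpt).trans ?_
  rw [← Finset.mul_expect]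
  exact mul_le_mul_of_nonneg_left (h.variance_gradient y) (sq_nonneg _)

lemma step_g_redraw_last (O : Oracle d l n m) (s : State d l) (b : StepBatch n m p)
    (c : Fin p.Bf → Fin n) :
    (step O p s (b.1, b.2.1, c)).val.g = (step O p s b).val.g := by
  rw [step_g, step_g]

lemma step_G_redraw_last (O : Oracle d l n m) (s : State d l) (b : StepBatch n m p)
    (c : Fin p.Bf → Fin n) :
    (step O p s (b.1, b.2.1, c)).val.G = (step O p s b).val.G := by
  rw [step_G, step_G]

variable [NeZero n]

/-- With `G`, `G'`, `y`, `y'` fixed, this is `storm_step` for the samples `G'ᵀ∇fᵢ(y')` and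
`Gᵀ∇fᵢ(y)`. Their difference is split into a change of matrix, paid by `Mf`, and a change of
argument, paid by `Γ Lf`. -/
lemma expect_outer_batch_le (h : Assumptions κ f g x₀) (hκ : κ.Admissible) {B : ℕ} (hB : 0 < B)
    {a : ℝ} (ha : a ∈ Set.Ioo (0 : ℝ) 1) {Γ : ℝ} {G G' : Jac d l} (hG : ‖G‖ ≤ Γ) (hG' : ‖G'‖ ≤ Γ)
    (u : Vec d) (y y' : Vec l) :
    (𝔼 c : Fin B → Fin n, ‖(1 - a) • u
        + a • G'.adjoint ((B : ℝ)⁻¹ • ∑ k, gradient (f (c k)) y')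
        + (1 - a) • (G'.adjoint ((B : ℝ)⁻¹ • ∑ k, gradient (f (c k)) y')
          - G.adjoint ((B : ℝ)⁻¹ • ∑ k, gradient (f (c k)) y))
        - G'.adjoint (gradient (outerFun f) y')‖ ^ 2)
      ≤ (1 - a) * ‖u - G.adjoint (gradient (outerFun f) y)‖ ^ 2
        + (B : ℝ)⁻¹ * (2 * a ^ 2 * (Γ ^ 2 * κ.H₁)
          + 2 * (2 * κ.Mf ^ 2 * frobNorm (G' - G) ^ 2 + 2 * (Γ * κ.Lf) ^ 2 * ‖y' - y‖ ^ 2)) := by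
  have hMf := hκ.Mf_pos.le
  have hLf := hκ.Lf_nonneg
  have hΓ0 : 0 ≤ Γ := (norm_nonneg _).trans hG
  simp only [map_smul, map_sum]
  refine storm_step hB ha.1.le ha.2.le _ _ _ (fun i => G'.adjoint (gradient (f i) y'))
    (fun i => G.adjoint (gradient (f i) y))
    (sum_adjoint_gradient_sub h.differentiable_f _ _)
    (sum_adjoint_gradient_sub h.differentiable_f _ _)
    (expect_norm_adjoint_sub_sq_le h hG' y') (expect_le_const fun i => ?_)
  have h1 : ‖G'.adjoint (gradient (f i) y') - G.adjoint (gradient (f i) y)‖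
      ≤ κ.Mf * frobNorm (G' - G) + Γ * κ.Lf * ‖y' - y‖ := by
    refine (norm_adjoint_sub_adjoint_le _ _ _ _).trans (add_le_add ?_ ?_)
    · rw [mul_comm]
      exact mul_le_mul (h.bound_gradient i _) (norm_le_frobNorm _) (norm_nonneg _) hMf
    · rw [mul_assoc]
      exact mul_le_mul hG (h.lipschitz_gradient i _ _) (norm_nonneg _) hΓ0
  refine (pow_le_pow_left₀ (norm_nonneg _) h1 2).trans ((add_sq_le_two _ _).trans ?_)
  rw [mul_pow, mul_pow _ ‖y' - y‖, ← mul_assoc, ← mul_assoc]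

variable [NeZero m]

lemma expect_outerError_step (h : Assumptions κ f g x₀) (hη : 0 ≤ p.η) (hε : 0 ≤ p.ε)
    (hκ : κ.Admissible) (hBg : 0 < p.Bg) (hBJ : 0 < p.BJ) (hBf : 0 < p.Bf)
    (haJ : p.aJ ∈ Set.Ioo (0 : ℝ) 1) (haΦ : p.aΦ ∈ Set.Ioo (0 : ℝ) 1) {Γ : ℝ}
    (hΓ : p.aJ * κ.Mg + κ.Lg * (p.η * p.ε) ≤ p.aJ * Γ) (s : State d l) (hs : ‖s.G‖ ≤ Γ) :
    (𝔼 b, outerError f (step (ifo f g) p s b).val) ≤ (1 - p.aΦ) * outerError f s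
      + (p.Bf : ℝ)⁻¹ * (2 * p.aΦ ^ 2 * (Γ ^ 2 * κ.H₁)
        + 2 * (2 * κ.Mf ^ 2 * (3 * (p.aJ ^ 2 * jacobianError g s + p.aJ ^ 2 * κ.H₂
            + (κ.Lg * (p.η * p.ε)) ^ 2))
          + 2 * (Γ * κ.Lf) ^ 2 * (3 * (p.ag ^ 2 * valueError g s + p.ag ^ 2 * κ.H₃
            + (κ.Mg * (p.η * p.ε)) ^ 2)))) := by
  -- First average over the minibatch of `f` only: the new `g` and `G` do not depend on it and count
  -- as constants. Their increments are averaged afterwards.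
  have hinner : ∀ b : StepBatch n m p,
      (𝔼 c, outerError f (step (ifo f g) p s (b.1, b.2.1, c)).val) ≤ (1 - p.aΦ) * outerError f s
        + (p.Bf : ℝ)⁻¹ * (2 * p.aΦ ^ 2 * (Γ ^ 2 * κ.H₁)
          + 2 * (2 * κ.Mf ^ 2 * frobNorm ((step (ifo f g) p s b).val.G - s.G) ^ 2
            + 2 * (Γ * κ.Lf) ^ 2 * ‖(step (ifo f g) p s b).val.g - s.g‖ ^ 2)) := by
    intro b
    simp_rw [outerError, step_F, step_g_redraw_last, step_G_redraw_last, ifo_meanGradient]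
    exact expect_outer_batch_le h hκ hBf haΦ hs
      (norm_step_G_le h hη hε hκ.Lg_nonneg haJ hBJ hΓ s hs b) _ _ _
  rw [expect_redraw_last]
  refine (expect_mono hinner).trans ?_
  rw [expect_const_add, ← Finset.mul_expect, expect_const_add, ← Finset.mul_expect,
    Finset.expect_add_distrib, ← Finset.mul_expect, ← Finset.mul_expect]
  have hX' := expect_jacobian_increment h hη hε hκ.Lg_nonneg hBJ s
  have hY' := expect_value_increment h hη hε hκ.Mg_pos.le hBg s
  gcongr

end OuterStep

/-! ### From the three separate errors to the error of the gradient estimator. -/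

section TotalError

variable {κ : Constants} {f : Fin n → Vec l → ℝ} {g : Fin m → Vec d → Vec l} {x₀ : Vec d}

lemma totalError_le (h : Assumptions κ f g x₀) (hκ : κ.Admissible) (hn : 0 < n) (hm : 0 < m)
    (s : State d l) :
    totalError f g s ≤ 3 * outerError f s + 3 * (κ.Mf ^ 2 * jacobianError g s)
      + 3 * ((κ.Mg * κ.Lf) ^ 2 * valueError g s) := by
  have hMf := hκ.Mf_pos.le
  have hMg := hκ.Mg_pos.le
  rw [totalError, gradient_objective h.differentiable_f h.differentiable_g]
  set J := fderiv ℝ (innerFun g) s.x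
  set v := gradient (outerFun f) s.g
  set w := gradient (outerFun f) (innerFun g s.x)
  -- Replace `G` by the true Jacobian while the gradient is still taken at the estimate, then move
  -- the argument; thus only bounds on `∇f` and on the true Jacobian enter, and none on `G`.
  have hsplit : s.F - J.adjoint w
      = (s.F - s.G.adjoint v) + (s.G - J).adjoint v + J.adjoint (v - w) := by
    rw [map_sub, map_sub, sub_apply]
    abel
  have h1 : ‖(s.G - J).adjoint v‖ ≤ κ.Mf * frobNorm (s.G - J) := by
    refine (norm_adjoint_apply_le _ _).trans ?_
    rw [mul_comm]
    exact mul_le_mul (h.norm_gradient_outerFun_le hn _) (norm_le_frobNorm _) (norm_nonneg _) hMf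
  have h2 : ‖J.adjoint (v - w)‖ ≤ κ.Mg * κ.Lf * ‖s.g - innerFun g s.x‖ := by
    refine (norm_adjoint_apply_le _ _).trans ?_
    rw [mul_assoc]
    exact mul_le_mul (h.norm_fderiv_innerFun_le hm _) (h.gradient_outerFun_sub_le hn _ _)
      (norm_nonneg _) hMg
  rw [hsplit]
  refine (norm_add_add_sq_le _ _ _).trans ?_
  rw [outerError, jacobianError, valueError, ← mul_pow, ← mul_pow]
  gcongr

end TotalError

/-! ### Errors of the initial estimators. -/

section Start

variable {κ : Constants} {f : Fin n → Vec l → ℝ} {g : Fin m → Vec d → Vec l} {x₀ : Vec d}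
  {p : Params}

lemma start_x (O : Oracle d l n m) (b : StartBatch n m p) : (start O p x₀ b).val.x = x₀ := rfl

lemma start_g (O : Oracle d l n m) (b : StartBatch n m p) :
    (start O p x₀ b).val.g = (O.meanValue b.1 x₀).val := rfl

lemma start_G (O : Oracle d l n m) (b : StartBatch n m p) :
    (start O p x₀ b).val.G = (O.meanJacobian b.2.1 x₀).val := rfl

lemma start_F (O : Oracle d l n m) (b : StartBatch n m p) :
    (start O p x₀ b).val.F
      = (start O p x₀ b).val.G.adjoint (O.meanGradient b.2.2 (start O p x₀ b).val.g).val := rfl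

lemma start_g_redraw_last (O : Oracle d l n m) (b : StartBatch n m p) (c : Fin p.Sf → Fin n) :
    (start O p x₀ (b.1, b.2.1, c)).val.g = (start O p x₀ b).val.g := by
  rw [start_g, start_g]

lemma start_G_redraw_last (O : Oracle d l n m) (b : StartBatch n m p) (c : Fin p.Sf → Fin n) :
    (start O p x₀ (b.1, b.2.1, c)).val.G = (start O p x₀ b).val.G := by
  rw [start_G, start_G]

lemma norm_start_G_le (h : Assumptions κ f g x₀) (hS : 0 < p.SJ) (b : StartBatch n m p) :
    ‖(start (ifo f g) p x₀ b).val.G‖ ≤ κ.Mg := by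
  rw [start_G, ifo_meanJacobian]
  exact norm_average_le hS _ fun k => h.bound_jacobian (b.2.1 k) x₀

variable [NeZero n] [NeZero m]

lemma expect_valueError_start (h : Assumptions κ f g x₀) (hS : 0 < p.Sg) :
    (𝔼 b, valueError g (start (ifo f g) p x₀ b).val) ≤ (p.Sg : ℝ)⁻¹ * κ.H₃ := by
  have : ∀ b : StartBatch n m p, valueError g (start (ifo f g) p x₀ b).val
      = ‖(p.Sg : ℝ)⁻¹ • ∑ k, (g (b.1 k) x₀ - innerFun g x₀)‖ ^ 2 := by
    intro b
    rw [← batch_sub hS fun j => g j x₀, valueError, start_g, start_x, ifo_meanValue]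
  simp_rw [this]
  rw [expect_fst fun b : Fin p.Sg → Fin m =>
      ‖(p.Sg : ℝ)⁻¹ • ∑ k, (g (b k) x₀ - innerFun g x₀)‖ ^ 2,
    expect_norm_sq_batch hS (fun j => g j x₀ - innerFun g x₀) (sum_value_sub g x₀)]
  have := h.variance_value x₀
  gcongr

lemma expect_jacobianError_start (h : Assumptions κ f g x₀) (hS : 0 < p.SJ) :
    (𝔼 b, jacobianError g (start (ifo f g) p x₀ b).val) ≤ (p.SJ : ℝ)⁻¹ * κ.H₂ := by
  have : ∀ b : StartBatch n m p, jacobianError g (start (ifo f g) p x₀ b).val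
      = ‖(p.SJ : ℝ)⁻¹ • ∑ k, (frobVec (fderiv ℝ (g (b.2.1 k)) x₀)
        - frobVec (fderiv ℝ (innerFun g) x₀))‖ ^ 2 := by
    intro b
    rw [← batch_sub hS fun j => frobVec (fderiv ℝ (g j) x₀), jacobianError, ← norm_frobVec,
      ← map_sum, ← map_smul, ← map_sub, start_G, start_x, ifo_meanJacobian]
  simp_rw [this]
  rw [expect_snd fun b : Fin p.SJ → Fin m => ‖(p.SJ : ℝ)⁻¹ • ∑ k,
        (frobVec (fderiv ℝ (g (b k)) x₀) - frobVec (fderiv ℝ (innerFun g) x₀))‖ ^ 2,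
    expect_norm_sq_batch hS
      (fun j => frobVec (fderiv ℝ (g j) x₀) - frobVec (fderiv ℝ (innerFun g) x₀))
      (sum_frobVec_sub h.differentiable_g x₀)]
  have := h.variance_jacobian x₀
  simp_rw [← map_sub, norm_frobVec]
  gcongr

lemma expect_outerError_start (h : Assumptions κ f g x₀) (hSJ : 0 < p.SJ) (hSf : 0 < p.Sf) :
    (𝔼 b, outerError f (start (ifo f g) p x₀ b).val) ≤ (p.Sf : ℝ)⁻¹ * (κ.Mg ^ 2 * κ.H₁) := by
  have hbatch : ∀ (G : Jac d l) (y : Vec l), ‖G‖ ≤ κ.Mg →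
      (𝔼 c : Fin p.Sf → Fin n, ‖G.adjoint ((p.Sf : ℝ)⁻¹ • ∑ k, gradient (f (c k)) y)
        - G.adjoint (gradient (outerFun f) y)‖ ^ 2) ≤ (p.Sf : ℝ)⁻¹ * (κ.Mg ^ 2 * κ.H₁) := by
    intro G y hG
    simp_rw [map_smul, map_sum, batch_sub hSf fun i => G.adjoint (gradient (f i) y)]
    rw [expect_norm_sq_batch hSf (fun i => G.adjoint (gradient (f i) y)
        - G.adjoint (gradient (outerFun f) y)) (sum_adjoint_gradient_sub h.differentiable_f _ _)]
    have := expect_norm_adjoint_sub_sq_le h hG y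
    gcongr
  rw [expect_redraw_last]
  refine expect_le_const fun b => ?_
  simp_rw [outerError, start_F, start_G_redraw_last, start_g_redraw_last, ifo_meanGradient]
  exact hbatch _ _ (norm_start_G_le h hSJ b)

end Start

/-! ### Counting the oracle calls -/

section Calls

lemma bind_calls {α β : Type} (c : Counted α) (k : α → Counted β) :
    (c >>= k).calls = c.calls + (k c.val).calls := rfl

lemma pure_calls {α : Type} (a : α) : (pure a : Counted α).calls = 0 := rfl

variable (f : Fin n → Vec l → ℝ) (g : Fin m → Vec d → Vec l) (p : Params)

lemma ifo_meanValue_calls {B : ℕ} (b : Fin B → Fin m) (x : Vec d) :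
    ((ifo f g).meanValue b x).calls = B := by
  simp [Oracle.meanValue, batchMean, bind_calls, pure_calls, ifo]

lemma ifo_meanJacobian_calls {B : ℕ} (b : Fin B → Fin m) (x : Vec d) :
    ((ifo f g).meanJacobian b x).calls = B := by
  simp [Oracle.meanJacobian, batchMean, bind_calls, pure_calls, ifo]

lemma ifo_meanGradient_calls {B : ℕ} (b : Fin B → Fin n) (y : Vec l) :
    ((ifo f g).meanGradient b y).calls = B := by
  simp [Oracle.meanGradient, batchMean, bind_calls, pure_calls, ifo]

lemma start_calls (x₀ : Vec d) (b : StartBatch n m p) :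
    (start (ifo f g) p x₀ b).calls = p.Sg + p.SJ + p.Sf := by
  simp only [start, bind_calls, pure_calls, ifo_meanValue_calls, ifo_meanJacobian_calls,
    ifo_meanGradient_calls]
  omega

lemma step_calls (s : State d l) (b : StepBatch n m p) :
    (step (ifo f g) p s b).calls = 2 * (p.Bg + p.BJ + p.Bf) := by
  simp only [step, bind_calls, pure_calls, ifo_meanValue_calls, ifo_meanJacobian_calls,
    ifo_meanGradient_calls]
  omega

lemma iterate_calls (x₀ : Vec d) (ω : Randomness n m p) (t : ℕ) :
    (iterate (ifo f g) p x₀ ω t).calls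
      = p.Sg + p.SJ + p.Sf + t * (2 * (p.Bg + p.BJ + p.Bf)) := by
  induction t with
  | zero => rw [iterate, start_calls]; omega
  | succ t ih => rw [iterate, bind_calls, step_calls, ih]; ring

end Calls

/-! ### Consequences of the parameter choice -/

section Scaling

variable {c C ε : ℝ}

lemma OfOrder.pos {u q : ℝ} (h : OfOrder c C u q) (hc : 0 < c) (hq : 0 < q) : 0 < u :=
  (mul_pos hc hq).trans_le h.1

lemma OfOrder.nat_inv_le {B : ℕ} (h : OfOrder c C B ε⁻¹) (hc : 0 < c) (hε : 0 < ε) :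
    (B : ℝ)⁻¹ ≤ ε / c := by
  have := inv_anti₀ (by positivity) h.1
  rwa [mul_inv, inv_inv, inv_mul_eq_div] at this

lemma OfOrder.nat_pos {B : ℕ} {q : ℝ} (h : OfOrder c C B q) (hc : 0 < c) (hq : 0 < q) :
    0 < B := by
  exact_mod_cast h.pos hc hq

lemma OfOrder.sq_le {a : ℝ} (h : OfOrder c C a ε) (hc : 0 < c) (hε : 0 < ε) :
    a ^ 2 ≤ C ^ 2 * ε ^ 2 := by
  rw [← mul_pow]
  exact pow_le_pow_left₀ (h.pos hc hε).le h.2 2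

variable {κ : Constants} {p : Params}

lemma Params.Scaled.η_mul_ε (hp : p.Scaled κ.LΦ c C) : p.η * p.ε = p.ε / κ.LΦ := by
  rw [hp.η_eq]; ring

/-- Smallness of `ε` is not assumed, but `c ε ≤ a_g < 1` bounds it. This absorbs surplus powers of
`ε`. -/
lemma Params.Scaled.ε_sq_le (hp : p.Scaled κ.LΦ c C) (hc : 0 < c) : p.ε ^ 2 ≤ (c ^ 2)⁻¹ := by
  have hε := hp.ε_pos
  have h1 : p.ε * c ≤ 1 := by linarith [hp.ag.1, hp.ag_mem.2]
  rw [← one_div, le_div_iff₀ (by positivity), ← mul_pow]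
  exact pow_le_one₀ (by positivity) h1

lemma Params.Scaled.T_mul_le (hp : p.Scaled κ.LΦ c C) : (p.T : ℝ) * p.ε ^ 2 ≤ C := by
  have hε := hp.ε_pos
  have := mul_le_mul_of_nonneg_right hp.T.2 (sq_nonneg p.ε)
  rwa [mul_assoc, ← mul_pow, inv_mul_cancel₀ hε.ne', one_pow, mul_one] at this

lemma Params.Scaled.le_T_mul (hp : p.Scaled κ.LΦ c C) : c ≤ (p.T : ℝ) * p.ε ^ 2 := by
  have hε := hp.ε_pos
  have := mul_le_mul_of_nonneg_right hp.T.1 (sq_nonneg p.ε)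
  rwa [mul_assoc, ← mul_pow, inv_mul_cancel₀ hε.ne', one_pow, mul_one] at this

end Scaling

/-! ### Summing the error recursions -/

lemma sum_le_of_contraction {u D : ℕ → ℝ} {a : ℝ} {N : ℕ}
    (h : ∀ t < N, u (t + 1) ≤ (1 - a) * u t + D t) :
    a * ∑ t ∈ Finset.range N, u t + u N ≤ u 0 + ∑ t ∈ Finset.range N, D t := by
  induction N with
  | zero => simp
  | succ N ih =>
    rw [Finset.sum_range_succ, Finset.sum_range_succ]
    linarith [ih fun t ht => h t (by omega), h N (by omega)]

/-- Telescoping gives `a ∑ u ≤ (A + A') ε`, and `a ≥ c ε` cancels the `ε`. -/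
lemma sum_le_of_contraction_of_order {u D : ℕ → ℝ} {a c ε A A' : ℝ} {N : ℕ} (hc : 0 < c)
    (hε : 0 < ε) (hu : ∀ t, 0 ≤ u t) (ha : c * ε ≤ a)
    (h : ∀ t < N, u (t + 1) ≤ (1 - a) * u t + D t) (h0 : u 0 ≤ A * ε)
    (hD : ∑ t ∈ Finset.range N, D t ≤ A' * ε) :
    ∑ t ∈ Finset.range N, u t ≤ (A + A') / c := by
  have h1 := sum_le_of_contraction h
  have h2 : 0 ≤ ∑ t ∈ Finset.range N, u t := Finset.sum_nonneg fun t _ => hu t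
  have h3 := mul_le_mul_of_nonneg_right ha h2
  rw [le_div_iff₀ hc]
  refine le_of_mul_le_mul_right ?_ hε
  nlinarith [hu N]

lemma expect_fst_batches [NeZero n] [NeZero m] {p : Params} (F : StartBatch n m p → ℝ) :
    (𝔼 b : Batches n m p, F b.1) = 𝔼 b, F b := by
  refine (expect_prod _).trans (Finset.expect_congr rfl fun b _ => ?_)
  exact Fintype.expect_const (ι := Fin (p.T + 1) → StepBatch n m p) (F b)

section Bounds

variable {c C : ℝ} {κ : Constants} {f : Fin n → Vec l → ℝ} {g : Fin m → Vec d → Vec l}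
  {x₀ : Vec d} {p : Params}

/-- Bound on the expected sum of the squared errors of `𝒈`. -/
noncomputable def valueBound (κ : Constants) (c C : ℝ) : ℝ :=
  (κ.H₃ / c + C * ((2 * C ^ 2 * κ.H₃ + 2 * (κ.Mg / κ.LΦ) ^ 2) / c)) / c

/-- Bound on the expected sum of the squared errors of `𝑮`. -/
noncomputable def jacobianBound (κ : Constants) (c C : ℝ) : ℝ :=
  (κ.H₂ / c + C * ((2 * C ^ 2 * κ.H₂ + 2 * (κ.Lg / κ.LΦ) ^ 2) / c)) / c

/-- Bound on the norms `‖𝑮_t‖`. -/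
noncomputable def radius (κ : Constants) (c : ℝ) : ℝ := κ.Mg + κ.Lg / (κ.LΦ * c)

/-- Bound on the expected sum of the squared errors of `𝑭` with respect to `𝑮ᵀ ∇f(𝒈)`. -/
noncomputable def outerBound (κ : Constants) (c C : ℝ) : ℝ :=
  (κ.Mg ^ 2 * κ.H₁ / c
    + (C * (2 * C ^ 2 * (radius κ c ^ 2 * κ.H₁)
        + 12 * κ.Mf ^ 2 * (C ^ 2 * κ.H₂ + (κ.Lg / κ.LΦ) ^ 2)
        + 12 * (radius κ c * κ.Lf) ^ 2 * (C ^ 2 * κ.H₃ + (κ.Mg / κ.LΦ) ^ 2))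
      + (c ^ 2)⁻¹ * (12 * κ.Mf ^ 2 * C ^ 2 * jacobianBound κ c C
        + 12 * (radius κ c * κ.Lf) ^ 2 * C ^ 2 * valueBound κ c C)) / c) / c

/-- Bound on the expected sum of the squared errors of `𝑭` with respect to `∇Φ(x)`. -/
noncomputable def totalBound (κ : Constants) (c C : ℝ) : ℝ :=
  3 * outerBound κ c C + 3 * (κ.Mf ^ 2 * jacobianBound κ c C)
    + 3 * ((κ.Mg * κ.Lf) ^ 2 * valueBound κ c C)

lemma noise_le {B : ℕ} {a H M : ℝ} (hc : 0 < c) (hε : 0 < p.ε) (hB : OfOrder c C B p.ε⁻¹)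
    (ha : OfOrder c C a p.ε) (hH : 0 ≤ H) (hp : p.Scaled κ.LΦ c C) :
    (B : ℝ)⁻¹ * (2 * a ^ 2 * H + 2 * (M * (p.η * p.ε)) ^ 2)
      ≤ (2 * C ^ 2 * H + 2 * (M / κ.LΦ) ^ 2) / c * p.ε ^ 3 := by
  have h1 := hB.nat_inv_le hc hε
  have h2 := ha.sq_le hc hε
  have h3 : 2 * a ^ 2 * H + 2 * (M * (p.η * p.ε)) ^ 2
      ≤ (2 * C ^ 2 * H + 2 * (M / κ.LΦ) ^ 2) * p.ε ^ 2 := by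
    have h4 : (M * (p.η * p.ε)) ^ 2 = (M / κ.LΦ) ^ 2 * p.ε ^ 2 := by
      rw [hp.η_mul_ε]; ring
    rw [h4]
    nlinarith [mul_le_mul_of_nonneg_right h2 hH]
  calc _ ≤ p.ε / c * ((2 * C ^ 2 * H + 2 * (M / κ.LΦ) ^ 2) * p.ε ^ 2) :=
        mul_le_mul h1 h3 (by positivity) (by positivity)
    _ = _ := by ring

lemma sum_noise_le {δ D : ℝ} (hδ : 0 ≤ δ) (hp : p.Scaled κ.LΦ c C) (hD : D ≤ δ * p.ε ^ 3) :
    ∑ _t ∈ Finset.range p.T, D ≤ C * δ * p.ε := by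
  have hε := hp.ε_pos
  rw [Finset.sum_const, Finset.card_range, nsmul_eq_mul]
  calc (p.T : ℝ) * D ≤ p.T * (δ * p.ε ^ 3) := by gcongr
    _ = p.T * p.ε ^ 2 * (δ * p.ε) := by ring
    _ ≤ C * (δ * p.ε) := mul_le_mul_of_nonneg_right hp.T_mul_le (by positivity)
    _ = _ := by ring

/-- The drift `Lg ε / LΦ` is at most `aJ Lg / (LΦ c)` because `c ε ≤ aJ`; this dictates the second
term of `radius`. -/
lemma radius_spec (hc : 0 < c) (hκ : κ.Admissible) (hp : p.Scaled κ.LΦ c C) :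
    p.aJ * κ.Mg + κ.Lg * (p.η * p.ε) ≤ p.aJ * radius κ c := by
  have hL := hκ.LΦ_pos
  have hLg := hκ.Lg_nonneg
  rw [radius, hp.η_mul_ε, mul_add]
  refine add_le_add le_rfl ?_
  rw [← mul_div_assoc, ← mul_div_assoc, div_le_div_iff₀ hL (by positivity)]
  have := mul_le_mul_of_nonneg_left hp.aJ.1 (mul_nonneg hLg hL.le)
  linarith

lemma radius_ge (hc : 0 < c) (hκ : κ.Admissible) : κ.Mg ≤ radius κ c := by
  have hL := hκ.LΦ_pos
  have hLg := hκ.Lg_nonneg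
  rw [radius]
  exact le_add_of_nonneg_right (by positivity)

lemma norm_trajectory_G_le (h : Assumptions κ f g x₀) (hc : 0 < c) (hκ : κ.Admissible)
    (hp : p.Scaled κ.LΦ c C) (b : Batches n m p) (t : ℕ) :
    ‖(trajectory (ifo f g) p x₀ b t).G‖ ≤ radius κ c := by
  have hε := hp.ε_pos
  have hη : 0 ≤ p.η := by rw [hp.η_eq]; exact one_div_nonneg.2 hκ.LΦ_pos.le
  induction t with
  | zero =>
    rw [trajectory]
    exact (norm_start_G_le h (hp.SJ.nat_pos hc (inv_pos.2 hε)) b.1).trans (radius_ge hc hκ)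
  | succ t ih =>
    rw [trajectory]
    exact norm_step_G_le h hη hε.le hκ.Lg_nonneg hp.aJ_mem (hp.BJ.nat_pos hc (inv_pos.2 hε))
      (radius_spec hc hκ hp) _ ih _

lemma valueError_nonneg (s : State d l) : 0 ≤ valueError g s := sq_nonneg _

lemma jacobianError_nonneg (s : State d l) : 0 ≤ jacobianError g s := sq_nonneg _

variable [NeZero n] [NeZero m]

lemma sum_valueError_le (h : Assumptions κ f g x₀) (hc : 0 < c) (hκ : κ.Admissible)
    (hp : p.Scaled κ.LΦ c C) :
    ∑ t ∈ Finset.range p.T, (𝔼 b, valueError g (trajectory (ifo f g) p x₀ b t))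
      ≤ valueBound κ c C := by
  have hε := hp.ε_pos
  have hH := hκ.H₃_pos.le
  have hη : 0 ≤ p.η := by rw [hp.η_eq]; exact one_div_nonneg.2 hκ.LΦ_pos.le
  refine sum_le_of_contraction_of_order (D := fun _ => (p.Bg : ℝ)⁻¹ * (2 * p.ag ^ 2 * κ.H₃
    + 2 * (κ.Mg * (p.η * p.ε)) ^ 2)) hc hε (fun t => Finset.expect_nonneg fun b _ => sq_nonneg _)
    hp.ag.1 (fun t ht => ?_) ?_
    (sum_noise_le (by positivity) hp (noise_le hc hε hp.Bg hp.ag hH hp))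
  · rw [expect_trajectory_succ _ _ _ ht.le]
    refine (expect_mono fun b => expect_valueError_step h hη hε.le hκ.Mg_pos.le hp.ag_mem
      (hp.Bg.nat_pos hc (inv_pos.2 hε)) _).trans ?_
    rw [Finset.expect_add_distrib, Fintype.expect_const, ← Finset.mul_expect]
  · simp only [trajectory]
    rw [expect_fst_batches fun b => valueError g (start (ifo f g) p x₀ b).val]
    refine (expect_valueError_start h (hp.Sg.nat_pos hc (inv_pos.2 hε))).trans ?_
    calc _ ≤ p.ε / c * κ.H₃ := mul_le_mul_of_nonneg_right (hp.Sg.nat_inv_le hc hε) hH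
      _ = _ := by ring

lemma sum_jacobianError_le (h : Assumptions κ f g x₀) (hc : 0 < c) (hκ : κ.Admissible)
    (hp : p.Scaled κ.LΦ c C) :
    ∑ t ∈ Finset.range p.T, (𝔼 b, jacobianError g (trajectory (ifo f g) p x₀ b t))
      ≤ jacobianBound κ c C := by
  have hε := hp.ε_pos
  have hH := hκ.H₂_pos.le
  have hη : 0 ≤ p.η := by rw [hp.η_eq]; exact one_div_nonneg.2 hκ.LΦ_pos.le
  refine sum_le_of_contraction_of_order (D := fun _ => (p.BJ : ℝ)⁻¹ * (2 * p.aJ ^ 2 * κ.H₂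
    + 2 * (κ.Lg * (p.η * p.ε)) ^ 2)) hc hε (fun t => Finset.expect_nonneg fun b _ => sq_nonneg _)
    hp.aJ.1 (fun t ht => ?_) ?_
    (sum_noise_le (by positivity) hp (noise_le hc hε hp.BJ hp.aJ hH hp))
  · rw [expect_trajectory_succ _ _ _ ht.le]
    refine (expect_mono fun b => expect_jacobianError_step h hη hε.le hκ.Lg_nonneg hp.aJ_mem
      (hp.BJ.nat_pos hc (inv_pos.2 hε)) _).trans ?_
    rw [Finset.expect_add_distrib, Fintype.expect_const, ← Finset.mul_expect]
  · simp only [trajectory]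
    rw [expect_fst_batches fun b => jacobianError g (start (ifo f g) p x₀ b).val]
    refine (expect_jacobianError_start h (hp.SJ.nat_pos hc (inv_pos.2 hε))).trans ?_
    calc _ ≤ p.ε / c * κ.H₂ := mul_le_mul_of_nonneg_right (hp.SJ.nat_inv_le hc hε) hH
      _ = _ := by ring

/-- Separates a constant part from the coupling to the current errors `P` and `Q`, which are to be
controlled only after summation over time. -/
lemma outer_noise_le (hc : 0 < c) (hκ : κ.Admissible) (hp : p.Scaled κ.LΦ c C) {Γ P Q : ℝ}
    (hP : 0 ≤ P) (hQ : 0 ≤ Q) :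
    (p.Bf : ℝ)⁻¹ * (2 * p.aΦ ^ 2 * (Γ ^ 2 * κ.H₁)
        + 2 * (2 * κ.Mf ^ 2 * (3 * (p.aJ ^ 2 * Q + p.aJ ^ 2 * κ.H₂
            + (κ.Lg * (p.η * p.ε)) ^ 2))
          + 2 * (Γ * κ.Lf) ^ 2 * (3 * (p.ag ^ 2 * P + p.ag ^ 2 * κ.H₃
            + (κ.Mg * (p.η * p.ε)) ^ 2))))
      ≤ p.ε ^ 3 / c * ((2 * C ^ 2 * (Γ ^ 2 * κ.H₁)
          + 12 * κ.Mf ^ 2 * (C ^ 2 * κ.H₂ + (κ.Lg / κ.LΦ) ^ 2)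
          + 12 * (Γ * κ.Lf) ^ 2 * (C ^ 2 * κ.H₃ + (κ.Mg / κ.LΦ) ^ 2))
        + (12 * κ.Mf ^ 2 * C ^ 2 * Q + 12 * (Γ * κ.Lf) ^ 2 * C ^ 2 * P)) := by
  have hε := hp.ε_pos
  have hH₁ := hκ.H₁_pos.le
  have hH₂ := hκ.H₂_pos.le
  have hH₃ := hκ.H₃_pos.le
  have h1 := hp.Bf.nat_inv_le hc hε
  have haΦ := hp.aΦ.sq_le hc hε
  have haJ := hp.aJ.sq_le hc hε
  have hag := hp.ag.sq_le hc hε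
  have hsq : ∀ M, (M * (p.η * p.ε)) ^ 2 = (M / κ.LΦ) ^ 2 * p.ε ^ 2 := by
    intro M
    rw [hp.η_mul_ε]; ring
  rw [hsq, hsq]
  calc _ ≤ p.ε / c * (2 * (C ^ 2 * p.ε ^ 2) * (Γ ^ 2 * κ.H₁)
        + 2 * (2 * κ.Mf ^ 2 * (3 * (C ^ 2 * p.ε ^ 2 * Q + C ^ 2 * p.ε ^ 2 * κ.H₂
            + (κ.Lg / κ.LΦ) ^ 2 * p.ε ^ 2))
          + 2 * (Γ * κ.Lf) ^ 2 * (3 * (C ^ 2 * p.ε ^ 2 * P + C ^ 2 * p.ε ^ 2 * κ.H₃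
            + (κ.Mg / κ.LΦ) ^ 2 * p.ε ^ 2)))) := by gcongr
    _ = _ := by ring

lemma sum_outerError_le (h : Assumptions κ f g x₀) (hc : 0 < c)
    (hκ : κ.Admissible) (hp : p.Scaled κ.LΦ c C) :
    ∑ t ∈ Finset.range p.T, (𝔼 b, outerError f (trajectory (ifo f g) p x₀ b t))
      ≤ outerBound κ c C := by
  have hε := hp.ε_pos
  have hεi := inv_pos.2 hε
  have hH₁ := hκ.H₁_pos.le
  have hH₂ := hκ.H₂_pos.le
  have hH₃ := hκ.H₃_pos.le
  have hη : 0 ≤ p.η := by rw [hp.η_eq]; exact one_div_nonneg.2 hκ.LΦ_pos.le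
  set P : ℕ → ℝ := fun t => 𝔼 b, valueError g (trajectory (ifo f g) p x₀ b t) with hPdef
  set Q : ℕ → ℝ := fun t => 𝔼 b, jacobianError g (trajectory (ifo f g) p x₀ b t) with hQdef
  have hP : ∀ t, 0 ≤ P t := fun t => Finset.expect_nonneg fun b _ => valueError_nonneg _
  have hQ : ∀ t, 0 ≤ Q t := fun t => Finset.expect_nonneg fun b _ => jacobianError_nonneg _
  have hPsum : ∑ t ∈ Finset.range p.T, P t ≤ valueBound κ c C := sum_valueError_le h hc hκ hp
  have hQsum : ∑ t ∈ Finset.range p.T, Q t ≤ jacobianBound κ c C :=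
    sum_jacobianError_le h hc hκ hp
  have hPb : 0 ≤ valueBound κ c C := (Finset.sum_nonneg fun t _ => hP t).trans hPsum
  have hQb : 0 ≤ jacobianBound κ c C := (Finset.sum_nonneg fun t _ => hQ t).trans hQsum
  set α : ℝ := 2 * C ^ 2 * (radius κ c ^ 2 * κ.H₁)
    + 12 * κ.Mf ^ 2 * (C ^ 2 * κ.H₂ + (κ.Lg / κ.LΦ) ^ 2)
    + 12 * (radius κ c * κ.Lf) ^ 2 * (C ^ 2 * κ.H₃ + (κ.Mg / κ.LΦ) ^ 2) with hα
  have hα0 : 0 ≤ α := by positivity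
  refine sum_le_of_contraction_of_order (D := fun t => p.ε ^ 3 / c * (α
    + (12 * κ.Mf ^ 2 * C ^ 2 * Q t + 12 * (radius κ c * κ.Lf) ^ 2 * C ^ 2 * P t))) hc hε
    (fun t => Finset.expect_nonneg fun b _ => sq_nonneg _) hp.aΦ.1 (fun t ht => ?_) ?_ ?_
  · rw [expect_trajectory_succ _ _ _ ht.le]
    refine (expect_mono fun b => (expect_outerError_step h hη hε.le hκ (hp.Bg.nat_pos hc hεi)
      (hp.BJ.nat_pos hc hεi) (hp.Bf.nat_pos hc hεi) hp.aJ_mem hp.aΦ_mem (radius_spec hc hκ hp) _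
      (norm_trajectory_G_le h hc hκ hp b t)).trans (add_le_add le_rfl
        (outer_noise_le hc hκ hp (valueError_nonneg _) (jacobianError_nonneg _)))).trans ?_
    rw [Finset.expect_add_distrib, ← Finset.mul_expect, ← Finset.mul_expect, expect_const_add,
      Finset.expect_add_distrib, ← Finset.mul_expect, ← Finset.mul_expect]
  · simp only [trajectory]
    rw [expect_fst_batches fun b => outerError f (start (ifo f g) p x₀ b).val]
    refine (expect_outerError_start h (hp.SJ.nat_pos hc hεi) (hp.Sf.nat_pos hc hεi)).trans ?_
    calc _ ≤ p.ε / c * (κ.Mg ^ 2 * κ.H₁) :=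
          mul_le_mul_of_nonneg_right (hp.Sf.nat_inv_le hc hε) (by positivity)
      _ = _ := by ring
  · rw [← Finset.mul_sum, Finset.sum_add_distrib (f := fun _ => α), Finset.sum_add_distrib
      (f := fun t => 12 * κ.Mf ^ 2 * C ^ 2 * Q t), ← Finset.mul_sum, ← Finset.mul_sum,
      Finset.sum_const, Finset.card_range, nsmul_eq_mul]
    -- Of the prefactor `ε³ / c`, one `ε` is kept for the required order. In the constant part `ε²`
    -- compensates the `T` summands; in the coupling part the sums are already bounded, so a bound
    -- on `ε²` is enough.
    have h1 : p.ε ^ 2 * (p.T * α) ≤ C * α := by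
      have := mul_le_mul_of_nonneg_right hp.T_mul_le hα0
      linarith
    have h2 := hp.ε_sq_le hc
    have h3 := Finset.sum_nonneg fun t (_ : t ∈ Finset.range p.T) => hP t
    have h4 := Finset.sum_nonneg fun t (_ : t ∈ Finset.range p.T) => hQ t
    calc _ = p.ε / c * (p.ε ^ 2 * (p.T * α)
          + p.ε ^ 2 * (12 * κ.Mf ^ 2 * C ^ 2 * ∑ t ∈ Finset.range p.T, Q t
            + 12 * (radius κ c * κ.Lf) ^ 2 * C ^ 2 * ∑ t ∈ Finset.range p.T, P t)) := by ring
      _ ≤ p.ε / c * (C * α + (c ^ 2)⁻¹ * (12 * κ.Mf ^ 2 * C ^ 2 * jacobianBound κ c C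
            + 12 * (radius κ c * κ.Lf) ^ 2 * C ^ 2 * valueBound κ c C)) := by gcongr
      _ = _ := by ring

lemma sum_totalError_le (h : Assumptions κ f g x₀) (hc : 0 < c)
    (hκ : κ.Admissible) (hp : p.Scaled κ.LΦ c C) :
    ∑ t ∈ Finset.range p.T, (𝔼 b, totalError f g (trajectory (ifo f g) p x₀ b t))
      ≤ totalBound κ c C := by
  have h1 := sum_valueError_le h hc hκ hp
  have h2 := sum_jacobianError_le h hc hκ hp
  have h3 := sum_outerError_le h hc hκ hp
  refine (Finset.sum_le_sum fun t _ => expect_mono fun b =>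
    totalError_le h hκ (NeZero.pos n) (NeZero.pos m) _).trans ?_
  simp only [Finset.expect_add_distrib, Finset.sum_add_distrib, ← Finset.mul_expect,
    ← Finset.mul_sum]
  rw [totalBound]
  gcongr

end Bounds

/-! ### Descent along the trajectory -/

section Descent

variable {c C : ℝ} {κ : Constants} {f : Fin n → Vec l → ℝ} {g : Fin m → Vec d → Vec l}
  {x₀ : Vec d} {p : Params}

lemma nextPoint_eq (hη : 0 < p.η) (s : State d l) :
    nextPoint p s = s.x + -(min (p.ε / ‖s.F‖) (1 / 2) * p.η) • s.F := by
  have h : p.η * p.ε / (p.η * ‖s.F‖) = p.ε / ‖s.F‖ := mul_div_mul_left _ _ hη.ne'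
  simp only [nextPoint, sub_sub_cancel_left, norm_neg, norm_smul, Real.norm_of_nonneg hη.le, h,
    smul_neg, neg_smul, mul_smul]

/-- If the first entry is the minimum, the right side is `ε r`; otherwise it is `r² / 2`, and `(r -
ε)² ≥ 0` applies. -/
lemma step_size_mul_sq_ge {r ε : ℝ} (hr : 0 ≤ r) (hε : 0 < ε) :
    ε * r - ε ^ 2 / 2 ≤ min (ε / r) (1 / 2) * r ^ 2 := by
  rcases hr.eq_or_lt with rfl | hr
  · norm_num
    positivity
  · rw [min_mul_of_nonneg _ _ (by positivity), le_min_iff]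
    constructor
    · rw [pow_two r, ← mul_assoc, div_mul_cancel₀ _ hr.ne']
      nlinarith [sq_nonneg ε]
    · nlinarith [sq_nonneg (r - ε)]

/-- One iteration controls the gradient at the new iterate by the decrease of `Φ` and the error of
the gradient estimator. -/
lemma gradient_nextPoint_le (h : Assumptions κ f g x₀) (hn : 0 < n) (hm : 0 < m)
    (hκ : κ.Admissible) (hp : p.Scaled κ.LΦ c C) (s : State d l) :
    p.ε * ‖gradient (objective f g) (nextPoint p s)‖
      ≤ 4 * κ.LΦ * (objective f g s.x - objective f g (nextPoint p s))
        + 3 / 2 * totalError f g s + 2 * p.ε ^ 2 := by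
  have hL := hκ.LΦ_pos
  have hε := hp.ε_pos
  have hη : 0 < p.η := by rw [hp.η_eq]; positivity
  have hLη : κ.LΦ * p.η = 1 := by rw [hp.η_eq]; field_simp
  set v := gradient (objective f g) s.x with hv
  set e := ‖s.F - v‖ with he
  set r := ‖s.F‖ with hr
  set γ := min (p.ε / r) (1 / 2) with hγ
  have hr0 : 0 ≤ r := norm_nonneg _
  have hγ0 : 0 ≤ γ := le_min (by positivity) (by norm_num)
  have hγ1 : γ ≤ 1 / 2 := min_le_right _ _
  have hsize : p.ε * r - p.ε ^ 2 / 2 ≤ γ * r ^ 2 := step_size_mul_sq_ge hr0 hε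
  have hdesc : objective f g (nextPoint p s) ≤ objective f g s.x - γ * p.η * inner ℝ v s.F
      + κ.LΦ / 2 * (γ * p.η) ^ 2 * r ^ 2 := by
    have := descent_inequality
      (fun x => (hasGradientAt_objective h.differentiable_f h.differentiable_g x).differentiableAt)
      (h.gradient_objective_sub_le hn hm) s.x (-(γ * p.η) • s.F)
    rw [← nextPoint_eq hη, inner_smul_right, norm_smul, mul_pow, norm_neg, Real.norm_eq_abs,
      sq_abs] at this
    linarith
  -- Polarization, with `‖v‖²` discarded.
  have hinner : r ^ 2 - e ^ 2 ≤ 2 * inner ℝ v s.F := by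
    have := norm_sub_sq_real s.F v
    rw [real_inner_comm] at this
    nlinarith [sq_nonneg ‖v‖]
  -- Since `LΦ η = 1`, the left side is at least `4γ⟪v, F⟫ - 2γ²r²`. By `hinner` and `γ ≤ 1/2` this
  -- is at least `2γ(r² - e²) - γr²`, and again `2γ ≤ 1`.
  have hdecr : 4 * κ.LΦ * (objective f g s.x - objective f g (nextPoint p s))
      ≥ γ * r ^ 2 - e ^ 2 := by
    have h1 : objective f g s.x - objective f g (nextPoint p s)
        ≥ γ * p.η * inner ℝ v s.F - κ.LΦ / 2 * (γ * p.η) ^ 2 * r ^ 2 := by linarith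
    have h2 : 4 * κ.LΦ * (γ * p.η * inner ℝ v s.F - κ.LΦ / 2 * (γ * p.η) ^ 2 * r ^ 2)
        = 4 * γ * (κ.LΦ * p.η) * inner ℝ v s.F - 2 * γ ^ 2 * (κ.LΦ * p.η) ^ 2 * r ^ 2 := by
      ring
    rw [hLη] at h2
    have h3 := mul_le_mul_of_nonneg_left h1 (by positivity : 0 ≤ 4 * κ.LΦ)
    have h4 := mul_le_mul_of_nonneg_left hinner hγ0
    have h5 : γ * e ^ 2 ≤ 1 / 2 * e ^ 2 := by gcongr
    have h6 : γ * (γ * r ^ 2) ≤ 1 / 2 * (γ * r ^ 2) := by gcongr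
    nlinarith
  have hgrad : ‖gradient (objective f g) (nextPoint p s)‖ ≤ p.ε + (e + r) := by
    have h1 := h.gradient_objective_sub_le hn hm (nextPoint p s) s.x
    have h2 := mul_le_mul_of_nonneg_left (norm_nextPoint_sub_le hη.le hε.le s) hL.le
    rw [← mul_assoc, hLη, one_mul] at h2
    have h3 : ‖v‖ ≤ e + r := by
      have := norm_sub_le s.F (s.F - v)
      rw [sub_sub_cancel] at this
      linarith
    have h4 := norm_sub_norm_le (gradient (objective f g) (nextPoint p s)) v
    linarith
  have hprod := mul_le_mul_of_nonneg_left hgrad hε.le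
  have htot : totalError f g s = e ^ 2 := rfl
  rw [htot]
  -- The mixed term `ε e` is split by the arithmetic-geometric mean inequality; `ε r` is bounded by
  -- `hsize` and then `hdecr`.
  nlinarith [sq_nonneg (e - p.ε)]

lemma trajectory_succ_x (O : Oracle d l n m) (b : Batches n m p) (t : ℕ) :
    (trajectory O p x₀ b (t + 1)).x = nextPoint p (trajectory O p x₀ b t) := by
  rw [trajectory, step_x]

/-- The decreases of `Φ` telescope. The gradients are those at `x₁, …, x_T`, exactly the candidates
for the output, while the errors are those at times `0, …, T - 1`. -/
lemma sum_gradient_le (h : Assumptions κ f g x₀) (hn : 0 < n) (hm : 0 < m)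
    (hκ : κ.Admissible) (hp : p.Scaled κ.LΦ c C) (b : Batches n m p) :
    p.ε * ∑ t ∈ Finset.range p.T,
        ‖gradient (objective f g) (trajectory (ifo f g) p x₀ b (t + 1)).x‖
      ≤ (4 * κ.LΦ * κ.Δ + 2 * p.ε ^ 2 * p.T)
        + 3 / 2 * ∑ t ∈ Finset.range p.T, totalError f g (trajectory (ifo f g) p x₀ b t) := by
  rw [Finset.mul_sum]
  have hstep : ∀ t ∈ Finset.range p.T,
      p.ε * ‖gradient (objective f g) (trajectory (ifo f g) p x₀ b (t + 1)).x‖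
        ≤ 4 * κ.LΦ * (objective f g (trajectory (ifo f g) p x₀ b t).x
            - objective f g (trajectory (ifo f g) p x₀ b (t + 1)).x)
          + 3 / 2 * totalError f g (trajectory (ifo f g) p x₀ b t) + 2 * p.ε ^ 2 := by
    intro t _
    rw [trajectory_succ_x]
    exact gradient_nextPoint_le h hn hm hκ hp _
  refine (Finset.sum_le_sum hstep).trans ?_
  rw [Finset.sum_add_distrib, Finset.sum_add_distrib, ← Finset.mul_sum, ← Finset.mul_sum,
    Finset.sum_range_sub' fun t => objective f g (trajectory (ifo f g) p x₀ b t).x,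
    Finset.sum_const, Finset.card_range, nsmul_eq_mul, trajectory, start_x]
  have hgap : objective f g x₀ - objective f g (trajectory (ifo f g) p x₀ b p.T).x ≤ κ.Δ := by
    have := ciInf_le h.bddBelow (trajectory (ifo f g) p x₀ b p.T).x
    linarith [h.gap]
  have := mul_le_mul_of_nonneg_left hgap (mul_nonneg (by norm_num : (0 : ℝ) ≤ 4) hκ.LΦ_pos.le)
  linarith

end Descent

/-! ### The complexity of STORM-Compositional -/

section Main

variable {c C : ℝ} {κ : Constants} {f : Fin n → Vec l → ℝ} {g : Fin m → Vec d → Vec l}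
  {x₀ : Vec d} {p : Params}

lemma expect_randomness (F : Batches n m p → Fin p.T → ℝ) :
    (𝔼 ω : Randomness n m p, F (ω.1, ω.2.1) ω.2.2) = 𝔼 b, 𝔼 k, F b k := by
  refine (expect_prod _).trans (Eq.trans ?_ (expect_prod _).symm)
  exact Finset.expect_congr rfl fun b₀ _ => expect_prod _

lemma expect_gradient_le [NeZero n] [NeZero m] (h : Assumptions κ f g x₀) (hc : 0 < c)
    (hκ : κ.Admissible) (hp : p.Scaled κ.LΦ c C) :
    (𝔼 ω : Randomness n m p, ‖gradient (objective f g) (algorithm (ifo f g) p x₀ ω).val‖)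
      ≤ ((4 * κ.LΦ * |κ.Δ| + 3 / 2 * |totalBound κ c C|) / c + 2) * p.ε := by
  have hε := hp.ε_pos
  have hL := hκ.LΦ_pos
  have hT : (0 : ℝ) < p.T := hp.T.pos hc (by positivity)
  simp only [algorithm, iterate_val]
  rw [expect_randomness fun b k =>
    ‖gradient (objective f g) (trajectory (ifo f g) p x₀ b (k + 1)).x‖]
  simp_rw [Fintype.expect_eq_sum_div_card (ι := Fin p.T), Fintype.card_fin]
  rw [← Finset.expect_div, div_le_iff₀ hT]
  have hsum : ∀ b : Batches n m p,
      ∑ k : Fin p.T, ‖gradient (objective f g) (trajectory (ifo f g) p x₀ b (k + 1)).x‖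
        = ∑ t ∈ Finset.range p.T,
          ‖gradient (objective f g) (trajectory (ifo f g) p x₀ b (t + 1)).x‖ := fun b =>
    (Finset.sum_range fun t =>
      ‖gradient (objective f g) (trajectory (ifo f g) p x₀ b (t + 1)).x‖).symm
  simp_rw [hsum]
  have hpath := expect_mono fun b => sum_gradient_le h (NeZero.pos n) (NeZero.pos m) hκ hp b
  rw [← Finset.mul_expect, expect_const_add, ← Finset.mul_expect] at hpath
  have htot := (sum_totalError_le h hc hκ hp).trans (le_abs_self _)
  rw [← Finset.expect_sum_comm] at htot
  -- The constant must be positive and is fixed before any instance is given, while `Δ` carries no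
  -- sign condition; absolute values avoid discussing signs.
  have hΔ : 4 * κ.LΦ * κ.Δ ≤ 4 * κ.LΦ * |κ.Δ| := by gcongr; exact le_abs_self _
  set A := 4 * κ.LΦ * |κ.Δ| + 3 / 2 * |totalBound κ c C| with hA
  have hA0 : 0 ≤ A := by positivity
  have hAT : A ≤ A / c * (p.T * p.ε ^ 2) := by
    rw [div_mul_eq_mul_div, le_div_iff₀ hc]
    exact mul_le_mul_of_nonneg_left hp.le_T_mul hA0
  refine le_of_mul_le_mul_left ?_ hε
  calc _ ≤ _ := hpath
    _ ≤ A + 2 * p.ε ^ 2 * p.T := by linarith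
    _ ≤ A / c * (p.T * p.ε ^ 2) + 2 * p.ε ^ 2 * p.T := by linarith
    _ = _ := by ring

lemma calls_le (hc : 0 < c) (hC : c ≤ C) (hp : p.Scaled κ.LΦ c C) (ω : Randomness n m p) :
    ((algorithm (ifo f g) p x₀ ω).calls : ℝ)
      ≤ (3 * C * (c ^ 2)⁻¹ + 12 * C ^ 2) * p.ε⁻¹ ^ 3 := by
  have hε := hp.ε_pos
  have hC0 : 0 < C := hc.trans_le hC
  set q := p.ε⁻¹ with hq
  have hq0 : 0 < q := inv_pos.2 hε
  have hT1 : (1 : ℝ) ≤ p.T := by exact_mod_cast hp.T.nat_pos hc (by positivity)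
  -- There are `T + 1` iterations; as `T` is a positive integer, the extra one costs at most a
  -- factor two.
  have hT2 : (p.T : ℝ) + 1 ≤ 2 * (C * q ^ 2) := by linarith [hp.T.2]
  have hB : (2 : ℝ) * (p.Bg + p.BJ + p.Bf) ≤ 6 * (C * q) := by
    linarith [hp.Bg.2, hp.BJ.2, hp.Bf.2]
  -- The initial minibatches cost order `ε⁻¹`, which is dominated by `ε⁻³` since `ε` is bounded.
  have hqq : q ≤ (c ^ 2)⁻¹ * q ^ 3 := by
    have h1 := mul_le_mul_of_nonneg_right (hp.ε_sq_le hc) (pow_pos hq0 3).le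
    have h2 : p.ε ^ 2 * q ^ 3 = q := by rw [hq]; field_simp
    linarith
  have hcalls : ((algorithm (ifo f g) p x₀ ω).calls : ℝ)
      = p.Sg + p.SJ + p.Sf + (p.T + 1) * (2 * (p.Bg + p.BJ + p.Bf)) := by
    rw [algorithm, iterate_calls]
    push_cast
    ring
  rw [hcalls]
  calc _ ≤ 3 * C * q + 2 * (C * q ^ 2) * (6 * (C * q)) := by
        refine add_le_add (by linarith [hp.Sg.2, hp.SJ.2, hp.Sf.2]) ?_
        gcongr
    _ ≤ 3 * C * ((c ^ 2)⁻¹ * q ^ 3) + 2 * (C * q ^ 2) * (6 * (C * q)) := by gcongr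
    _ = _ := by ring

end Main

end Storm

theorem corollary3p1 (c C : ℝ) (hc : 0 < c) (hC : c ≤ C)
    (κ : Storm.Constants) (hκ : κ.Admissible) :
    ∃ K : ℝ, 0 < K ∧
      ∀ (d l n m : ℕ), 0 < n → 0 < m →
      ∀ (f : Fin n → Storm.Vec l → ℝ) (g : Fin m → Storm.Vec d → Storm.Vec l)
        (x₀ : Storm.Vec d), Storm.Assumptions κ f g x₀ →
      ∀ p : Storm.Params, p.Scaled κ.LΦ c C →
        (𝔼 ω : Storm.Randomness n m p,
            ‖gradient (Storm.objective f g)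
              (Storm.algorithm (Storm.ifo f g) p x₀ ω).val‖) ≤ K * p.ε ∧
        ∀ ω : Storm.Randomness n m p,
          ((Storm.algorithm (Storm.ifo f g) p x₀ ω).calls : ℝ) ≤ K * p.ε⁻¹ ^ 3 := by
  have hC0 : 0 < C := hc.trans_le hC
  have hL := hκ.LΦ_pos
  set K₁ := (4 * κ.LΦ * |κ.Δ| + 3 / 2 * |Storm.totalBound κ c C|) / c + 2 with hK₁
  set K₂ := 3 * C * (c ^ 2)⁻¹ + 12 * C ^ 2 with hK₂
  have hK₁0 : 0 < K₁ := by positivity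
  have hK₂0 : 0 < K₂ := by positivity
  refine ⟨K₁ + K₂, by positivity, fun d l n m hn hm f g x₀ h p hp => ?_⟩
  have : NeZero n := ⟨hn.ne'⟩
  have : NeZero m := ⟨hm.ne'⟩
  have hε := hp.ε_pos
  refine ⟨(Storm.expect_gradient_le h hc hκ hp).trans ?_,
    fun ω => (Storm.calls_le hc hC hp ω).trans ?_⟩
  · exact mul_le_mul_of_nonneg_right (by linarith) hε.le
  · exact mul_le_mul_of_nonneg_right (by linarith) (by positivity)
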